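/- Let $m$ be a natural number and let $\{\mathbf x_k\}_{k\in\mathbb Z}$ and $\{\mathbf y_k\}_{k\in\mathbb Z}$ be zero-mean, discrete-time stochastic processes with values in $\mathbb R^m$ and finite second moments. For $a\in\mathbb Z$ and $n\ge 0$ write $\mathbf x_{a,\ldots,a+n}=[\mathbf x_a^{\mathrm T},\ldots,\mathbf x_{a+n}^{\mathrm T}]^{\mathrm T}\in\mathbb R^{(n+1)m}$, and likewise for $\mathbf y$. Assume: (i) (stationarity) $\mathbb E[\mathbf x_i\mathbf x_{i+k}^{\mathrm T}]=R_{\mathbf x}(k)$ and $\mathbb E[\mathbf y_i\mathbf y_{i+k}^{\mathrm T}]=R_{\mathbf y}(k)$ do not depend on $i$; (ii) (ellipticity with the same density generator) for every $n\ge0$ there is a measurable function $g_n:\mathbb R\to[0,\infty)$ such that, for every $a\in\mathbb Z$, the vectors $\mathbf x_{a,\ldots,a+n}$ and $\mathbf y_{a,\ldots,a+n}$ have probability densities of the form $v\mapsto \det(S)^{-1/2}\,g_n(v^{\mathrm T}S^{-1}v)$, each with its own positive definite matrix $S$; (iii) the series $\Phi_{\mathbf x}(\omega)=\sum_{k=-\infty}^{\infty}R_{\mathbf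 x}(k)\mathrm e^{-\mathrm j\omega k}$ and $\Phi_{\mathbf y}(\omega)=\sum_{k=-\infty}^{\infty}R_{\mathbf y}(k)\mathrm e^{-\mathrm j\omega k}$ defining the power spectra converge absolutely, and $\Phi_{\mathbf x}(\omega)$, $\Phi_{\mathbf y}(\omega)$ are positive definite for every real $\omega$. Define the average $\mathcal W_2$ distance between the laws of the two processes by $$\mathcal W_2\left(p_{\{\mathbf x_k\}};p_{\{\mathbf y_k\}}\right)=\left(\inf\ \limsup_{i\to\infty}\frac{\mathbb E\left[\|\mathbf x_{0,\ldots,i}-\mathbf y_{0,\ldots,i}\|^2\right]}{i+1}\right)^{1/2},$$ where the infimum is over all couplings of the two processes, that is, over all joint laws of $(\{\mathbf x_k\},\{\mathbf y_k\})$ whose marginals are the given laws $p_{\{\mathbf x_k\}}$ and $p_{\{\mathbf y_k\}}$, and $\|\cdot\|$ is the Euclidean norm. Put $$W[\Phi_{\mathbf x}(\omega),\Phi_{\mathbf y}(\omega)]=\Phi_{\mathbf x}(\omega)+\Phi_{\mathbf y}(\omega)-2\left[\Phi_{\mathbf x}^{1/2}(\omega)\,\Phi_{\mathbf y}(\omega)\,\Phi_{\mathbf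 x}^{1/2}(\omega)\right]^{1/2}.$$ Then $\omega\mapsto\operatorname{tr}W[\Phi_{\mathbf x}(\omega),\Phi_{\mathbf y}(\omega)]$ is integrable on $[0,2\pi]$ and $$\mathcal W_2\left(p_{\{\mathbf x_k\}};p_{\{\mathbf y_k\}}\right)=\sqrt{\frac1{2\pi}\int_0^{2\pi}\operatorname{tr}\left\{W[\Phi_{\mathbf x}(\omega),\Phi_{\mathbf y}(\omega)]\right\}\mathrm d\omega}.$$ -/

import Mathlib

open MeasureTheory Filter
open scoped ENNReal NNReal MatrixOrder ComplexOrder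

noncomputable section

namespace SpectralWasserstein

/-- The random vector `x_{a,…,a+n}` obtained by stacking `n + 1` consecutive values of a path. -/
def block {m : ℕ} (a : ℤ) (n : ℕ) (x : ℤ → EuclideanSpace ℝ (Fin m)) :
    EuclideanSpace ℝ (Fin (n + 1) × Fin m) :=
  WithLp.toLp 2 fun p => x (a + ((p.1 : ℕ) : ℤ)) p.2

/-- The law, on path space, of a discrete-time process. -/
def processLaw {m : ℕ} {Ω : Type*} [MeasurableSpace Ω] (P : Measure Ω)
    (x : ℤ → Ω → EuclideanSpace ℝ (Fin m)) : Measure (ℤ → EuclideanSpace ℝ (Fin m)) :=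
  P.map fun s k => x k s

/-- The couplings of two measures. -/
def couplings {α β : Type*} [MeasurableSpace α] [MeasurableSpace β]
    (μ : Measure α) (ν : Measure β) : Set (Measure (α × β)) :=
  {γ | γ.map Prod.fst = μ ∧ γ.map Prod.snd = ν}

/-- The average `W_p` distance between two laws of processes:
the `p`-th root of the infimum over all couplings of
`limsup_i E ‖x_{0,…,i} - y_{0,…,i}‖ ^ p / (i + 1)`. -/
def avgWasserstein {m : ℕ} (p : ℝ) (μ ν : Measure (ℤ → EuclideanSpace ℝ (Fin m))) : ℝ≥0∞ :=
  (⨅ γ ∈ couplings μ ν,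
    limsup (fun i : ℕ => (∫⁻ z, ‖block 0 i z.1 - block 0 i z.2‖ₑ ^ p ∂γ) / ((i : ℝ≥0∞) + 1))
      atTop) ^ (1 / p)

/-- The auto-correlation `R(i, k) = E[x_i x_{i+k}ᵀ]`. -/
def autocorr {m : ℕ} {Ω : Type*} [MeasurableSpace Ω] (P : Measure Ω)
    (x : ℤ → Ω → EuclideanSpace ℝ (Fin m)) (i k : ℤ) : Matrix (Fin m) (Fin m) ℝ :=
  Matrix.of fun a b => ∫ s, x i s a * x (i + k) s b ∂P

/-- Stationarity of a process with finite second moments: `R(i, k)` depends only on `k`. -/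
structure IsStationary {m : ℕ} {Ω : Type*} [MeasurableSpace Ω] (P : Measure Ω)
    (x : ℤ → Ω → EuclideanSpace ℝ (Fin m)) : Prop where
  memLp : ∀ k, MemLp (x k) 2 P
  autocorr_eq : ∀ i j k, autocorr P x i k = autocorr P x j k

/-- The term `R(k) e^{-jωk}` of the power spectrum of a stationary process,
with `R(k) = R(0, k)`. -/
def spectrumTerm {m : ℕ} {Ω : Type*} [MeasurableSpace Ω] (P : Measure Ω)
    (x : ℤ → Ω → EuclideanSpace ℝ (Fin m)) (w : ℝ) (k : ℤ) : Matrix (Fin m) (Fin m) ℂ :=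
  Complex.exp (-(Complex.I * w * k)) • (autocorr P x 0 k).map ((↑) : ℝ → ℂ)

/-- The power spectrum `Φ(ω) = ∑_{k ∈ ℤ} R(k) e^{-jωk}` of a stationary process. -/
def powerSpectrum {m : ℕ} {Ω : Type*} [MeasurableSpace Ω] (P : Measure Ω)
    (x : ℤ → Ω → EuclideanSpace ℝ (Fin m)) (w : ℝ) : Matrix (Fin m) (Fin m) ℂ :=
  ∑' k : ℤ, spectrumTerm P x w k

/-- A measure on a Euclidean space is a centred elliptical distribution with density generator
`g` if, for some positive definite scatter matrix `S`, it has the density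
`det(S)^{-1/2} g(vᵀ S⁻¹ v)` (the normalizing constant is part of `g`). -/
def IsElliptical {ι : Type*} [Fintype ι] [DecidableEq ι] (μ : Measure (EuclideanSpace ℝ ι))
    (g : ℝ → ℝ≥0) : Prop :=
  Measurable g ∧ ∃ S : Matrix ι ι ℝ, S.PosDef ∧
    μ = volume.withDensity fun v : EuclideanSpace ℝ ι =>
      ENNReal.ofReal ((√S.det)⁻¹ * (g (v.ofLp ⬝ᵥ S⁻¹.mulVec v.ofLp) : ℝ))

/-- A (zero-mean) elliptical process: each vector `x_{a,…,a+n}` is elliptical. The density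
generator of a vector depends on its dimension, so the density generator of a process is a
family `g`, where `g n` is the one of the vectors of `n + 1` consecutive values. -/
def IsEllipticalProcess {m : ℕ} {Ω : Type*} [MeasurableSpace Ω] (P : Measure Ω)
    (x : ℤ → Ω → EuclideanSpace ℝ (Fin m)) (g : ℕ → ℝ → ℝ≥0) : Prop :=
  ∀ (a : ℤ) (n : ℕ), IsElliptical (P.map fun s => block a n fun k => x k s) (g n)

/-- `W[A, B] = A + B - 2 (A^{1/2} B A^{1/2})^{1/2}`. -/
def buresMatrix {m : ℕ} (A B : Matrix (Fin m) (Fin m) ℂ) : Matrix (Fin m) (Fin m) ℂ :=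
  A + B - (2 : ℂ) • CFC.sqrt (CFC.sqrt A * B * CFC.sqrt A)

end SpectralWasserstein

end

/-! Both inequalities are proved in L². A stationary process with spectrum Φ is there a family of
vectors `ξ`, and `output ξ` sends finite real filters u, v with frequency responses û, v̂ to vectors
with inner product (2π)⁻¹ ∫ ûᴴ Φ v̂ (`HasSpectrum.inner_output`). The squared distance at one time
is a constant minus twice the trace of the cross-correlation, so the time average of that trace is
to be maximised. With T = (Φx^{1/2} Φy Φx^{1/2})^{1/2}, the maximum is (2π)⁻¹ ∫ tr T.

Attainment (`exists_coupling_eq`): filter x by the symbol A = Φx^{-1/2} T Φx^{-1/2}. Since A Φx A =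
Φy, the output has the second-order structure of y, and the common density generator upgrades this
to equality of laws. Indeed an elliptical vector is a linear image of a spherical one, so the law of
a linear functional depends only on its variance (`IsElliptical.integral_exp_eq`), and these laws
determine the law of the process (`measure_ext_of_output`). The output is only an L² limit of finite
filters, which `IsEllipticalProcess.expMean_eq_of_tendsto` accommodates. Finally tr(Φx A) = tr T
gives the cost.

Lower bound (`HasSpectrum.two_mul_le_meanTrace`): a coupling need not be jointly stationary, so no
cross-spectrum is available. Averaging the cross-correlations over time along an ultrafilter gives
instead a shift-invariant bilinear form ρ with |ρ(u, v)| ≤ ‖`output ξ u`‖ ‖`output η v`‖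
(`HasSpectrum.exists_crossForm`). Shift invariance moves a filter from one argument of ρ to the
other. Hence, if G Fᴴ = 1, the sum of ρ(F e_c, G e_c) over c equals that of ρ(e_c, e_c), up to
approximation by finite filters, and AM-GM bounds its double by (2π)⁻¹ ∫ tr(Fᴴ Φx F + Gᴴ Φy G). The
choice F = Φx^{-1/2} T^{1/2}, G = Φx^{1/2} T^{-1/2} makes both traces equal to tr T. -/

noncomputable section

namespace SpectralWasserstein

/-! ### Matrix square roots, real symbols and the optimal transport matrix -/

section MatrixAnalysis

open Matrix Topology ComplexConjugate

variable {ι : Type*} [Fintype ι] [DecidableEq ι]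

open scoped Matrix.Norms.L2Operator in
theorem continuous_matrix_sqrt {X : Type*} [TopologicalSpace X] {A : X → Matrix ι ι ℂ}
    (hA : Continuous A) (hA0 : ∀ w, (A w).PosSemidef) :
    Continuous fun w => CFC.sqrt (A w) :=
  Continuous.cfcₙ_nnreal_of_mem_nhdsSet (s := Set.univ) NNReal.sqrt Filter.univ_mem hA
    (fun w => (hA0 w).nonneg) NNReal.continuous_sqrt.continuousOn

theorem continuous_matrix_inv {X : Type*} [TopologicalSpace X] {A : X → Matrix ι ι ℂ}
    (hA : Continuous A) (hA0 : ∀ w, IsUnit (A w)) : Continuous fun w => (A w)⁻¹ := by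
  refine continuous_iff_continuousAt.2 fun w => ?_
  refine ContinuousAt.comp (f := A) (g := Inv.inv) (continuousAt_matrix_inv _ ?_) hA.continuousAt
  have h := (Matrix.isUnit_iff_isUnit_det _).1 (hA0 w)
  have := NormedRing.inverse_continuousAt h.unit
  simpa using this

theorem PosDef.sqrt {𝕜 : Type*} [RCLike 𝕜] {A : Matrix ι ι 𝕜} (hA : A.PosDef) :
    (CFC.sqrt A).PosDef := by
  have h := (CFC.sqrt_nonneg A).posSemidef
  refine h.posDef_iff_isUnit.2 ?_
  have h2 : IsUnit (CFC.sqrt A * CFC.sqrt A) := by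
    rw [CFC.sqrt_mul_sqrt_self A hA.posSemidef.nonneg]; exact hA.isUnit
  exact isUnit_of_mul_isUnit_left h2

/-- Entrywise complex conjugation as a ring homomorphism. -/
def conjHom : Matrix ι ι ℂ →+* Matrix ι ι ℂ := (starRingEnd ℂ).mapMatrix

theorem conjHom_apply (A : Matrix ι ι ℂ) (i j : ι) : conjHom A i j = conj (A i j) := rfl

theorem conjHom_posSemidef {A : Matrix ι ι ℂ} (hA : A.PosSemidef) : (conjHom A).PosSemidef := by
  have : conjHom A = Aᵀ := by
    ext i j
    rw [conjHom_apply, transpose_apply, ← hA.1.apply j i]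
    simp
  rw [this]
  exact hA.transpose

/-- Conjugation is multiplicative and preserves positivity, so uniqueness of the positive root
applies. This keeps the symbols built from power spectra realisable by real filters. -/
theorem conjHom_sqrt {A : Matrix ι ι ℂ} (hA : A.PosSemidef) :
    CFC.sqrt (conjHom A) = conjHom (CFC.sqrt A) := by
  refine CFC.sqrt_unique ?_ (conjHom_posSemidef (CFC.sqrt_nonneg A).posSemidef).nonneg
  rw [← map_mul, CFC.sqrt_mul_sqrt_self A hA.nonneg]

theorem conjHom_inv {A : Matrix ι ι ℂ} (hA : IsUnit A) : (conjHom A)⁻¹ = conjHom A⁻¹ := by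
  refine Matrix.inv_eq_right_inv ?_
  rw [← map_mul, Matrix.mul_nonsing_inv _ ((Matrix.isUnit_iff_isUnit_det _).1 hA), map_one]

/-- A continuous `2π`-periodic matrix function which is the frequency response of a filter with real
coefficients. -/
structure IsRealSymbol (A : ℝ → Matrix ι ι ℂ) : Prop where
  continuous : Continuous A
  periodic : Function.Periodic A (2 * Real.pi)
  neg : ∀ w, A (-w) = conjHom (A w)

theorem IsRealSymbol.mul {A B : ℝ → Matrix ι ι ℂ} (hA : IsRealSymbol A) (hB : IsRealSymbol B) :
    IsRealSymbol fun w => A w * B w where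
  continuous := hA.continuous.matrix_mul hB.continuous
  periodic w := by simp only [hA.periodic w, hB.periodic w]
  neg w := by simp only [hA.neg, hB.neg, map_mul]

theorem IsRealSymbol.sqrt {A : ℝ → Matrix ι ι ℂ} (hA : IsRealSymbol A)
    (hp : ∀ w, (A w).PosSemidef) : IsRealSymbol fun w => CFC.sqrt (A w) where
  continuous := continuous_matrix_sqrt hA.continuous hp
  periodic w := by simp only [hA.periodic w]
  neg w := by simp only [hA.neg, conjHom_sqrt (hp w)]

theorem IsRealSymbol.inv {A : ℝ → Matrix ι ι ℂ} (hA : IsRealSymbol A)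
    (hp : ∀ w, IsUnit (A w)) : IsRealSymbol fun w => (A w)⁻¹ where
  continuous := continuous_matrix_inv hA.continuous hp
  periodic w := by simp only [hA.periodic w]
  neg w := by simp only [hA.neg, conjHom_inv (hp w)]

/-- The cross term `(A^{1/2} B A^{1/2})^{1/2}` of the Bures distance. -/
def fidelity (A B : Matrix ι ι ℂ) : Matrix ι ι ℂ := CFC.sqrt (CFC.sqrt A * B * CFC.sqrt A)

theorem posDef_sqrt_mul_mul_sqrt {A B : Matrix ι ι ℂ} (hA : A.PosDef) (hB : B.PosDef) :
    (CFC.sqrt A * B * CFC.sqrt A).PosDef := by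
  have hs := PosDef.sqrt hA
  have h := hB.posSemidef.conjTranspose_mul_mul_same (CFC.sqrt A)
  rw [hs.1.eq] at h
  exact h.posDef_iff_isUnit.2 ((hs.isUnit.mul hB.isUnit).mul hs.isUnit)

theorem posDef_fidelity {A B : Matrix ι ι ℂ} (hA : A.PosDef) (hB : B.PosDef) :
    (fidelity A B).PosDef :=
  PosDef.sqrt (posDef_sqrt_mul_mul_sqrt hA hB)

theorem fidelity_mul_self {A B : Matrix ι ι ℂ} (hA : A.PosDef) (hB : B.PosDef) :
    fidelity A B * fidelity A B = CFC.sqrt A * B * CFC.sqrt A :=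
  CFC.sqrt_mul_sqrt_self _ (posDef_sqrt_mul_mul_sqrt hA hB).posSemidef.nonneg

/-- The optimal transport map `A^{-1/2} (A^{1/2} B A^{1/2})^{1/2} A^{-1/2}` from `A` to `B`. -/
def transportMap (A B : Matrix ι ι ℂ) : Matrix ι ι ℂ :=
  (CFC.sqrt A)⁻¹ * fidelity A B * (CFC.sqrt A)⁻¹

/-- The factor `A^{-1/2} T^{1/2}` with `T = (A^{1/2} B A^{1/2})^{1/2}`. -/
def primalFactor (A B : Matrix ι ι ℂ) : Matrix ι ι ℂ :=
  (CFC.sqrt A)⁻¹ * CFC.sqrt (fidelity A B)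

/-- The factor `A^{1/2} T^{-1/2}` with `T = (A^{1/2} B A^{1/2})^{1/2}`. -/
def dualFactor (A B : Matrix ι ι ℂ) : Matrix ι ι ℂ :=
  CFC.sqrt A * (CFC.sqrt (fidelity A B))⁻¹

section Identities

variable {A B : Matrix ι ι ℂ}

theorem transportMap_isHermitian : (transportMap A B)ᴴ = transportMap A B := by
  have h1 : (CFC.sqrt A)ᴴ = CFC.sqrt A := (CFC.sqrt_nonneg A).posSemidef.1
  have h2 : (fidelity A B)ᴴ = fidelity A B := (CFC.sqrt_nonneg _).posSemidef.1
  simp only [transportMap, conjTranspose_mul, conjTranspose_nonsing_inv, h1, h2, Matrix.mul_assoc]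

/-- The inner factors A^{±1/2} cancel, leaving A^{-1/2} T² A^{-1/2} with T² = A^{1/2} B A^{1/2}. In
terms of processes: filtering turns spectrum `A` into spectrum `B`. -/
theorem transportMap_mul_mul (hA : A.PosDef) (hB : B.PosDef) :
    (transportMap A B)ᴴ * A * transportMap A B = B := by
  rw [transportMap_isHermitian]
  have hu := (Matrix.isUnit_iff_isUnit_det _).1 (PosDef.sqrt hA).isUnit
  have hs := CFC.sqrt_mul_sqrt_self A hA.posSemidef.nonneg
  have ht := fidelity_mul_self hA hB
  calc transportMap A B * A * transportMap A B
      = transportMap A B * (CFC.sqrt A * CFC.sqrt A) * transportMap A B := by rw [hs]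
    _ = (CFC.sqrt A)⁻¹ * fidelity A B * ((CFC.sqrt A)⁻¹ * CFC.sqrt A) *
        (CFC.sqrt A * (CFC.sqrt A)⁻¹) * fidelity A B * (CFC.sqrt A)⁻¹ := by
      simp only [transportMap, Matrix.mul_assoc]
    _ = (CFC.sqrt A)⁻¹ * (fidelity A B * fidelity A B) * (CFC.sqrt A)⁻¹ := by
      rw [Matrix.nonsing_inv_mul _ hu, Matrix.mul_nonsing_inv _ hu]
      simp only [Matrix.mul_one, Matrix.mul_assoc]
    _ = ((CFC.sqrt A)⁻¹ * CFC.sqrt A) * B * (CFC.sqrt A * (CFC.sqrt A)⁻¹) := by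
      rw [ht]; simp only [Matrix.mul_assoc]
    _ = B := by rw [Matrix.nonsing_inv_mul _ hu, Matrix.mul_nonsing_inv _ hu]; simp

theorem trace_mul_transportMap (hA : A.PosDef) :
    (A * transportMap A B).trace = (fidelity A B).trace := by
  have hu := (Matrix.isUnit_iff_isUnit_det _).1 (PosDef.sqrt hA).isUnit
  have hs := CFC.sqrt_mul_sqrt_self A hA.posSemidef.nonneg
  calc (A * transportMap A B).trace
      = (CFC.sqrt A * CFC.sqrt A * transportMap A B).trace := by rw [hs]
    _ = (CFC.sqrt A * (CFC.sqrt A * (CFC.sqrt A)⁻¹ * (fidelity A B * (CFC.sqrt A)⁻¹))).trace := by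
      simp only [transportMap, Matrix.mul_assoc]
    _ = (fidelity A B * ((CFC.sqrt A)⁻¹ * CFC.sqrt A)).trace := by
      rw [Matrix.mul_nonsing_inv _ hu, Matrix.one_mul, Matrix.trace_mul_comm, Matrix.mul_assoc]
    _ = (fidelity A B).trace := by rw [Matrix.nonsing_inv_mul _ hu, Matrix.mul_one]

/-- The constraint G Fᴴ = 1 of the duality bound. The next two identities show that this pair
balances the two sides of AM-GM, which makes the bound sharp. -/
theorem dualFactor_mul_conjTranspose_primalFactor (hA : A.PosDef) (hB : B.PosDef) :
    dualFactor A B * (primalFactor A B)ᴴ = 1 := by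
  have h1 : (CFC.sqrt A)ᴴ = CFC.sqrt A := (CFC.sqrt_nonneg A).posSemidef.1
  have h2 : (CFC.sqrt (fidelity A B))ᴴ = CFC.sqrt (fidelity A B) :=
    (CFC.sqrt_nonneg _).posSemidef.1
  have hu := (Matrix.isUnit_iff_isUnit_det _).1 (PosDef.sqrt hA).isUnit
  have hv := (Matrix.isUnit_iff_isUnit_det _).1 (PosDef.sqrt (posDef_fidelity hA hB)).isUnit
  simp only [dualFactor, primalFactor, conjTranspose_mul, conjTranspose_nonsing_inv, h1, h2]
  rw [Matrix.mul_assoc, Matrix.nonsing_inv_mul_cancel_left _ _ hv, Matrix.mul_nonsing_inv _ hu]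

theorem primalFactor_conj (hA : A.PosDef) (hB : B.PosDef) :
    (primalFactor A B)ᴴ * A * primalFactor A B = fidelity A B := by
  have h1 : (CFC.sqrt A)ᴴ = CFC.sqrt A := (CFC.sqrt_nonneg A).posSemidef.1
  have h2 : (CFC.sqrt (fidelity A B))ᴴ = CFC.sqrt (fidelity A B) :=
    (CFC.sqrt_nonneg _).posSemidef.1
  have hu := (Matrix.isUnit_iff_isUnit_det _).1 (PosDef.sqrt hA).isUnit
  have hs := CFC.sqrt_mul_sqrt_self A hA.posSemidef.nonneg
  have ht := CFC.sqrt_mul_sqrt_self _ (posDef_fidelity hA hB).posSemidef.nonneg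
  calc (primalFactor A B)ᴴ * A * primalFactor A B
      = (primalFactor A B)ᴴ * (CFC.sqrt A * CFC.sqrt A) * primalFactor A B := by rw [hs]
    _ = CFC.sqrt (fidelity A B) * ((CFC.sqrt A)⁻¹ * CFC.sqrt A) *
        (CFC.sqrt A * (CFC.sqrt A)⁻¹) * CFC.sqrt (fidelity A B) := by
      simp only [primalFactor, conjTranspose_mul, conjTranspose_nonsing_inv, h1, h2,
        Matrix.mul_assoc]
    _ = fidelity A B := by
      rw [Matrix.nonsing_inv_mul _ hu, Matrix.mul_nonsing_inv _ hu, Matrix.mul_one, Matrix.mul_one,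
        ht]

theorem dualFactor_conj (hA : A.PosDef) (hB : B.PosDef) :
    (dualFactor A B)ᴴ * B * dualFactor A B = fidelity A B := by
  have h1 : (CFC.sqrt A)ᴴ = CFC.sqrt A := (CFC.sqrt_nonneg A).posSemidef.1
  have h2 : (CFC.sqrt (fidelity A B))ᴴ = CFC.sqrt (fidelity A B) :=
    (CFC.sqrt_nonneg _).posSemidef.1
  have hv := (Matrix.isUnit_iff_isUnit_det _).1 (PosDef.sqrt (posDef_fidelity hA hB)).isUnit
  have ht := CFC.sqrt_mul_sqrt_self _ (posDef_fidelity hA hB).posSemidef.nonneg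
  set Q := CFC.sqrt (fidelity A B) with hQ
  calc (dualFactor A B)ᴴ * B * dualFactor A B
      = Q⁻¹ * (CFC.sqrt A * B * CFC.sqrt A) * Q⁻¹ := by
        simp only [dualFactor, ← hQ, conjTranspose_mul, conjTranspose_nonsing_inv, h1, h2,
          Matrix.mul_assoc]
    _ = (Q⁻¹ * Q) * Q * Q * (Q * Q⁻¹) := by
      rw [← fidelity_mul_self hA hB, ← ht]; simp only [Matrix.mul_assoc]
    _ = fidelity A B := by
      rw [Matrix.nonsing_inv_mul _ hv, Matrix.mul_nonsing_inv _ hv, Matrix.one_mul,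
        Matrix.mul_one, ht]

end Identities

section Symbols

variable {A B : ℝ → Matrix ι ι ℂ}

theorem IsRealSymbol.fidelity (hA : IsRealSymbol A) (hB : IsRealSymbol B)
    (hA0 : ∀ w, (A w).PosDef) (hB0 : ∀ w, (B w).PosDef) :
    IsRealSymbol fun w => fidelity (A w) (B w) :=
  (((hA.sqrt fun w => (hA0 w).posSemidef).mul hB).mul
    (hA.sqrt fun w => (hA0 w).posSemidef)).sqrt
      fun w => (posDef_sqrt_mul_mul_sqrt (hA0 w) (hB0 w)).posSemidef

theorem IsRealSymbol.transportMap (hA : IsRealSymbol A) (hB : IsRealSymbol B)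
    (hA0 : ∀ w, (A w).PosDef) (hB0 : ∀ w, (B w).PosDef) :
    IsRealSymbol fun w => transportMap (A w) (B w) :=
  have h := (hA.sqrt fun w => (hA0 w).posSemidef).inv fun w => (PosDef.sqrt (hA0 w)).isUnit
  (h.mul (hA.fidelity hB hA0 hB0)).mul h

theorem IsRealSymbol.primalFactor (hA : IsRealSymbol A) (hB : IsRealSymbol B)
    (hA0 : ∀ w, (A w).PosDef) (hB0 : ∀ w, (B w).PosDef) :
    IsRealSymbol fun w => primalFactor (A w) (B w) :=
  ((hA.sqrt fun w => (hA0 w).posSemidef).inv fun w => (PosDef.sqrt (hA0 w)).isUnit).mul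
    ((hA.fidelity hB hA0 hB0).sqrt fun w => (posDef_fidelity (hA0 w) (hB0 w)).posSemidef)

theorem IsRealSymbol.dualFactor (hA : IsRealSymbol A) (hB : IsRealSymbol B)
    (hA0 : ∀ w, (A w).PosDef) (hB0 : ∀ w, (B w).PosDef) :
    IsRealSymbol fun w => dualFactor (A w) (B w) :=
  (hA.sqrt fun w => (hA0 w).posSemidef).mul
    (((hA.fidelity hB hA0 hB0).sqrt fun w => (posDef_fidelity (hA0 w) (hB0 w)).posSemidef).inv
      fun w => (PosDef.sqrt (posDef_fidelity (hA0 w) (hB0 w))).isUnit)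

end Symbols

end MatrixAnalysis

/-! ### Frequency responses, their density, and the spectral inner product -/

section SpectralForm

open Matrix Topology ComplexConjugate

variable {m : ℕ}

/-- The frequency response `∑ u(k, a) e^{jωk} e_a` of a finitely supported real filter. -/
def freqResp (u : ℤ × Fin m →₀ ℝ) (w : ℝ) : Fin m → ℂ :=
  Finsupp.linearCombination ℝ
    (fun p : ℤ × Fin m => (Pi.single p.2 (Complex.exp (Complex.I * w * p.1)) : Fin m → ℂ)) u

theorem freqResp_add (u v : ℤ × Fin m →₀ ℝ) :
    freqResp (u + v) = fun w => freqResp u w + freqResp v w := by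
  funext w; simp [freqResp]

theorem freqResp_sub (u v : ℤ × Fin m →₀ ℝ) :
    freqResp (u - v) = fun w => freqResp u w - freqResp v w := by
  funext w; simp [freqResp]

theorem freqResp_smul (r : ℝ) (u : ℤ × Fin m →₀ ℝ) :
    freqResp (r • u) = fun w => r • freqResp u w := by
  funext w; simp [freqResp]

theorem freqResp_sum {κ : Type*} (s : Finset κ) (u : κ → ℤ × Fin m →₀ ℝ) (w : ℝ) :
    freqResp (∑ i ∈ s, u i) w = ∑ i ∈ s, freqResp (u i) w := by
  simp [freqResp, map_sum]

theorem freqResp_single (p : ℤ × Fin m) (r : ℝ) (w : ℝ) :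
    freqResp (Finsupp.single p r) w =
      Pi.single p.2 ((r : ℂ) * Complex.exp (Complex.I * w * p.1)) := by
  rw [freqResp, Finsupp.linearCombination_single, ← Pi.single_smul]
  simp

theorem freqResp_apply (u : ℤ × Fin m →₀ ℝ) (w : ℝ) (a : Fin m) :
    freqResp u w a =
      u.sum fun p r => if p.2 = a then (r : ℂ) * Complex.exp (Complex.I * w * p.1) else 0 := by
  rw [freqResp, Finsupp.linearCombination_apply, Finsupp.sum, Finset.sum_apply, Finsupp.sum]
  refine Finset.sum_congr rfl fun p _ => ?_
  rw [Pi.smul_apply, Pi.single_apply]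
  by_cases h : p.2 = a
  · simp [h]
  · simp [h, Ne.symm h]

/-- A continuous `2π`-periodic vector function with conjugate symmetry. -/
structure IsRealVec (f : ℝ → Fin m → ℂ) : Prop where
  continuous : Continuous f
  periodic : Function.Periodic f (2 * Real.pi)
  neg : ∀ w a, f (-w) a = conj (f w a)

theorem isRealVec_freqResp (u : ℤ × Fin m →₀ ℝ) : IsRealVec (freqResp u) where
  continuous := by
    refine continuous_pi fun a => ?_
    simp only [freqResp_apply, Finsupp.sum]
    refine continuous_finsetSum _ fun p _ => ?_
    split_ifs <;> fun_prop
  periodic w := by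
    ext a
    simp only [freqResp_apply]
    refine Finsupp.sum_congr fun p _ => ?_
    split_ifs
    · congr 1
      rw [Complex.exp_eq_exp_iff_exists_int]
      exact ⟨p.1, by push_cast; ring⟩
    · rfl
  neg w a := by
    simp only [freqResp_apply, Finsupp.sum, map_sum]
    refine Finset.sum_congr rfl fun p _ => ?_
    split_ifs
    · rw [map_mul, Complex.conj_ofReal, ← Complex.exp_conj]
      simp
    · simp

theorem IsRealSymbol.mulVec {A : ℝ → Matrix (Fin m) (Fin m) ℂ} {f : ℝ → Fin m → ℂ}
    (hA : IsRealSymbol A) (hf : IsRealVec f) : IsRealVec fun w => A w *ᵥ f w where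
  continuous := hA.continuous.matrix_mulVec hf.continuous
  periodic w := by simp only [hA.periodic w, hf.periodic w]
  neg w a := by
    simp only [Matrix.mulVec, dotProduct, hA.neg, conjHom_apply, hf.neg, map_sum, map_mul]

theorem IsRealVec.exists_bound {f : ℝ → Fin m → ℂ} (hf : IsRealVec f) :
    ∃ C, ∀ w, ‖f w‖ ≤ C := by
  obtain ⟨C, hC⟩ := isCompact_Icc.exists_bound_of_continuousOn
    (s := Set.Icc (0 : ℝ) (0 + 2 * Real.pi)) hf.continuous.continuousOn
  refine ⟨C, fun w => ?_⟩
  obtain ⟨v, hv, hvw⟩ := hf.periodic.exists_mem_Ico Real.two_pi_pos w 0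
  rw [hvw]
  exact hC v (Set.Ico_subset_Icc_self hv)

theorem exists_trigPoly_near {f : ℝ → ℂ} (hf : Continuous f)
    (hp : Function.Periodic f (2 * Real.pi)) {ε : ℝ} (hε : 0 < ε) :
    ∃ c : ℤ →₀ ℂ, ∀ w : ℝ,
      ‖(c.sum fun k z => z * Complex.exp (Complex.I * w * k)) - f w‖ ≤ ε := by
  have : Fact (0 < 2 * Real.pi) := ⟨Real.two_pi_pos⟩
  let F : C(AddCircle (2 * Real.pi), ℂ) := ⟨hp.lift, continuous_coinduced_dom.2 hf⟩
  have hF : F ∈ (Submodule.span ℂ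
      (Set.range (@fourier (2 * Real.pi)))).topologicalClosure := by
    rw [span_fourier_closure_eq_top]; trivial
  rw [← SetLike.mem_coe, Submodule.topologicalClosure_coe, Metric.mem_closure_iff] at hF
  obtain ⟨g, hg, hd⟩ := hF ε hε
  obtain ⟨c, hc⟩ := Finsupp.mem_span_range_iff_exists_finsupp.1 hg
  refine ⟨c, fun w => ?_⟩
  have h1 : (c.sum fun k z => z * Complex.exp (Complex.I * w * k)) = g (w : AddCircle _) := by
    rw [← hc, Finsupp.sum, Finsupp.sum, ContinuousMap.sum_apply]
    refine Finset.sum_congr rfl fun k _ => ?_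
    rw [ContinuousMap.smul_apply, fourier_coe_apply, smul_eq_mul]
    congr 2
    have : (Real.pi : ℂ) ≠ 0 := by exact_mod_cast Real.pi_ne_zero
    push_cast
    field_simp
  have h2 : f w = F (w : AddCircle _) := (hp.lift_coe w).symm
  rw [h1, h2, ← dist_eq_norm, dist_comm]
  exact (ContinuousMap.dist_apply_le_dist _).trans hd.le

/-- Taking real parts of the coefficients replaces q(ω) by the average of q(ω) and the conjugate of
q(-ω). This average fixes `f` and does not increase the uniform error. -/
theorem exists_real_trigPoly_near {f : ℝ → ℂ} (hf : Continuous f)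
    (hp : Function.Periodic f (2 * Real.pi)) (hn : ∀ w, f (-w) = conj (f w))
    {ε : ℝ} (hε : 0 < ε) :
    ∃ c : ℤ →₀ ℝ, ∀ w : ℝ,
      ‖(c.sum fun k r => (r : ℂ) * Complex.exp (Complex.I * w * k)) - f w‖ ≤ ε := by
  obtain ⟨c, hc⟩ := exists_trigPoly_near hf hp hε
  refine ⟨c.mapRange Complex.re Complex.zero_re, fun w => ?_⟩
  set q : ℝ → ℂ := fun w => c.sum fun k z => z * Complex.exp (Complex.I * w * k) with hq
  have h1 : ((c.mapRange Complex.re Complex.zero_re).sum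
      fun k r => (r : ℂ) * Complex.exp (Complex.I * w * k)) = (q w + conj (q (-w))) / 2 := by
    rw [Finsupp.sum_mapRange_index (by simp)]
    simp only [hq, Finsupp.sum, map_sum]
    rw [← Finset.sum_add_distrib, Finset.sum_div]
    refine Finset.sum_congr rfl fun k _ => ?_
    rw [map_mul, ← Complex.exp_conj]
    have : conj (Complex.I * ((-w : ℝ) : ℂ) * (k : ℂ)) = Complex.I * w * k := by simp
    rw [this, ← add_mul, Complex.add_conj]
    push_cast
    ring
  have h2 : f w = (f w + conj (f (-w))) / 2 := by
    rw [hn, Complex.conj_conj]; ring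
  have h3 := hc w
  have h4 := hc (-w)
  rw [h1, h2]
  have h5 : (q w + conj (q (-w))) / 2 - (f w + conj (f (-w))) / 2
      = ((q w - f w) + conj (q (-w) - f (-w))) / 2 := by rw [map_sub]; ring
  rw [h5, norm_div, Complex.norm_ofNat]
  have h6 := norm_add_le (q w - f w) (conj (q (-w) - f (-w)))
  rw [RCLike.norm_conj] at h6
  linarith

theorem IsRealVec.exists_freqResp_near {f : ℝ → Fin m → ℂ} (hf : IsRealVec f) {ε : ℝ}
    (hε : 0 < ε) : ∃ u : ℤ × Fin m →₀ ℝ, ∀ w, ‖freqResp u w - f w‖ ≤ ε := by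
  have h := fun a => exists_real_trigPoly_near (f := fun w => f w a)
    ((continuous_apply a).comp hf.continuous) (fun w => by simp only [hf.periodic w])
    (fun w => hf.neg w a) hε
  choose c hc using h
  refine ⟨∑ a, (c a).mapDomain fun k => (k, a), fun w => ?_⟩
  rw [pi_norm_le_iff_of_nonneg hε.le]
  intro a
  have h1 : freqResp (∑ a, (c a).mapDomain fun k => (k, a)) w a =
      (c a).sum fun k r => (r : ℂ) * Complex.exp (Complex.I * w * k) := by
    rw [freqResp_sum, Finset.sum_apply, Finset.sum_eq_single a]
    · rw [freqResp_apply, Finsupp.sum_mapDomain_index_inj (fun k l hkl => by simpa using hkl)]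
      simp
    · intro b _ hb
      rw [freqResp_apply, Finsupp.sum_mapDomain_index_inj (fun k l hkl => by simpa using hkl)]
      simp [hb]
    · simp
  rw [Pi.sub_apply, h1]
  exact hc a w

/-- Pointwise convergence with a uniform bound. -/
structure BddTendsto {κ : Type*} (U : κ → ℝ → Fin m → ℂ) (l : Filter κ) (f : ℝ → Fin m → ℂ) :
    Prop where
  bound : ∃ C, ∀ i w, ‖U i w‖ ≤ C
  tendsto : ∀ w, Tendsto (fun i => U i w) l (𝓝 (f w))

theorem BddTendsto.sub {κ : Type*} {U V : κ → ℝ → Fin m → ℂ} {l : Filter κ}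
    {f g : ℝ → Fin m → ℂ} (hU : BddTendsto U l f) (hV : BddTendsto V l g) :
    BddTendsto (fun i w => U i w - V i w) l (fun w => f w - g w) where
  bound := by
    obtain ⟨C, hC⟩ := hU.bound
    obtain ⟨D, hD⟩ := hV.bound
    exact ⟨C + D, fun i w => (norm_sub_le _ _).trans (add_le_add (hC i w) (hD i w))⟩
  tendsto w := (hU.tendsto w).sub (hV.tendsto w)

theorem BddTendsto.comp {κ κ' : Type*} {U : κ → ℝ → Fin m → ℂ} {l : Filter κ} {l' : Filter κ'}
    {f : ℝ → Fin m → ℂ} (hU : BddTendsto U l f) {φ : κ' → κ} (hφ : Tendsto φ l' l) :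
    BddTendsto (fun i => U (φ i)) l' f where
  bound := by
    obtain ⟨C, hC⟩ := hU.bound
    exact ⟨C, fun i w => hC _ w⟩
  tendsto w := (hU.tendsto w).comp hφ

theorem BddTendsto.const {κ : Type*} {l : Filter κ} {f : ℝ → Fin m → ℂ} (hf : IsRealVec f) :
    BddTendsto (fun _ : κ => f) l f where
  bound := hf.exists_bound.imp fun _ h _ => h
  tendsto _ := tendsto_const_nhds

/-- Uniform approximation to within 1/(n+1) gives the uniform bound as well as the limit; this is
the form in which dominated convergence uses it. -/
theorem IsRealVec.exists_bddTendsto {f : ℝ → Fin m → ℂ} (hf : IsRealVec f) :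
    ∃ u : ℕ → ℤ × Fin m →₀ ℝ, BddTendsto (fun n => freqResp (u n)) atTop f := by
  have h := fun n : ℕ => hf.exists_freqResp_near (Nat.one_div_pos_of_nat (α := ℝ) (n := n))
  choose u hu using h
  refine ⟨u, ?_, fun w => ?_⟩
  · obtain ⟨C, hC⟩ := hf.exists_bound
    refine ⟨C + 1, fun n w => ?_⟩
    have h1 : ‖freqResp (u n) w‖ ≤ ‖f w‖ + ‖freqResp (u n) w - f w‖ :=
      norm_le_norm_add_norm_sub' _ _
    have h2 : (1 : ℝ) / (n + 1) ≤ 1 := by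
      rw [div_le_one (by positivity)]; linarith [n.cast_nonneg (α := ℝ)]
    linarith [hC w, hu n w]
  · rw [tendsto_iff_norm_sub_tendsto_zero]
    exact squeeze_zero (fun _ => norm_nonneg _) (fun n => hu n w)
      tendsto_one_div_add_atTop_nhds_zero_nat

/-- The form `(2π)⁻¹ ∫ f(ω)ᴴ Φ(ω) g(ω) dω`. -/
def specForm (Φ : ℝ → Matrix (Fin m) (Fin m) ℂ) (f g : ℝ → Fin m → ℂ) : ℂ :=
  1 / (2 * Real.pi) * ∫ w in (0 : ℝ)..(2 * Real.pi), star (f w) ⬝ᵥ (Φ w *ᵥ g w)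

theorem norm_star_dotProduct_mulVec_le (M : Matrix (Fin m) (Fin m) ℂ) (p q : Fin m → ℂ) :
    ‖star p ⬝ᵥ (M *ᵥ q)‖ ≤ (∑ a, ∑ b, ‖M a b‖) * ‖p‖ * ‖q‖ := by
  simp only [dotProduct, mulVec, Finset.sum_mul, Finset.mul_sum]
  refine (norm_sum_le _ _).trans (Finset.sum_le_sum fun a _ => ?_)
  refine (norm_sum_le _ _).trans (Finset.sum_le_sum fun b _ => ?_)
  rw [norm_mul, norm_mul, Pi.star_apply, norm_star]
  have h1 := norm_le_pi_norm p a
  have h2 := norm_le_pi_norm q b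
  calc ‖p a‖ * (‖M a b‖ * ‖q b‖) = ‖M a b‖ * ‖p a‖ * ‖q b‖ := by ring
    _ ≤ ‖M a b‖ * ‖p‖ * ‖q‖ := by gcongr

theorem continuous_specForm_integrand {Φ : ℝ → Matrix (Fin m) (Fin m) ℂ} (hΦ : Continuous Φ)
    {f g : ℝ → Fin m → ℂ} (hf : Continuous f) (hg : Continuous g) :
    Continuous fun w => star (f w) ⬝ᵥ (Φ w *ᵥ g w) :=
  hf.star.dotProduct (hΦ.matrix_mulVec hg)

section Bilinear

variable {Φ : ℝ → Matrix (Fin m) (Fin m) ℂ} {f f' g g' : ℝ → Fin m → ℂ}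

theorem specForm_add_left (hΦ : Continuous Φ) (hf : Continuous f) (hf' : Continuous f')
    (hg : Continuous g) :
    specForm Φ (fun w => f w + f' w) g = specForm Φ f g + specForm Φ f' g := by
  simp only [specForm, star_add, add_dotProduct]
  rw [intervalIntegral.integral_add
    ((continuous_specForm_integrand hΦ hf hg).intervalIntegrable _ _)
    ((continuous_specForm_integrand hΦ hf' hg).intervalIntegrable _ _), mul_add]

theorem specForm_add_right (hΦ : Continuous Φ) (hf : Continuous f) (hg : Continuous g)
    (hg' : Continuous g') :
    specForm Φ f (fun w => g w + g' w) = specForm Φ f g + specForm Φ f g' := by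
  simp only [specForm, mulVec_add, dotProduct_add]
  rw [intervalIntegral.integral_add
    ((continuous_specForm_integrand hΦ hf hg).intervalIntegrable _ _)
    ((continuous_specForm_integrand hΦ hf hg').intervalIntegrable _ _), mul_add]

theorem specForm_smul_left (r : ℝ) : specForm Φ (fun w => r • f w) g = r * specForm Φ f g := by
  have : ∀ w, star (r • f w) ⬝ᵥ (Φ w *ᵥ g w) = (r : ℂ) * (star (f w) ⬝ᵥ (Φ w *ᵥ g w)) := by
    intro w; simp [smul_dotProduct]
  simp only [specForm, this]
  rw [intervalIntegral.integral_const_mul]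
  ring

theorem specForm_smul_right (r : ℝ) : specForm Φ f (fun w => r • g w) = r * specForm Φ f g := by
  have : ∀ w, star (f w) ⬝ᵥ (Φ w *ᵥ (r • g w)) = (r : ℂ) * (star (f w) ⬝ᵥ (Φ w *ᵥ g w)) := by
    intro w; simp [mulVec_smul, dotProduct_smul]
  simp only [specForm, this]
  rw [intervalIntegral.integral_const_mul]
  ring

/-- Symbols acting on the responses can be absorbed into the density: the effect of filtering on a
spectrum. -/
theorem specForm_mulVec (A B : ℝ → Matrix (Fin m) (Fin m) ℂ) :
    specForm Φ (fun w => A w *ᵥ f w) (fun w => B w *ᵥ g w) =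
      specForm (fun w => (A w)ᴴ * Φ w * B w) f g := by
  simp only [specForm, star_mulVec, ← mulVec_mulVec, dotProduct_mulVec, vecMul_vecMul]

theorem tendsto_specForm {κ : Type*} {l : Filter κ} [l.IsCountablyGenerated]
    {U V : κ → ℝ → Fin m → ℂ} (hΦ : Continuous Φ)
    (hUc : ∀ i, Continuous (U i)) (hVc : ∀ i, Continuous (V i))
    (hU : BddTendsto U l f) (hV : BddTendsto V l g) :
    Tendsto (fun i => specForm Φ (U i) (V i)) l (𝓝 (specForm Φ f g)) := by
  obtain ⟨C, hC⟩ := hU.bound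
  obtain ⟨D, hD⟩ := hV.bound
  refine Tendsto.const_mul _ ?_
  refine intervalIntegral.tendsto_integral_filter_of_dominated_convergence
    (fun w => (∑ a, ∑ b, ‖Φ w a b‖) * C * D) (.of_forall fun i =>
      (continuous_specForm_integrand hΦ (hUc i) (hVc i)).aestronglyMeasurable)
    (.of_forall fun i => .of_forall fun w _ => ?_) ?_ (.of_forall fun w _ => ?_)
  · refine (norm_star_dotProduct_mulVec_le _ _ _).trans ?_
    have h0 : 0 ≤ C := (norm_nonneg _).trans (hC i w)
    have h1 := hC i w
    have h2 := hD i w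
    gcongr
  · refine Continuous.intervalIntegrable ?_ _ _
    have : ∀ a b, Continuous fun w => Φ w a b := fun a b => hΦ.matrix_elem a b
    fun_prop
  · have hc : Continuous fun z : (Fin m → ℂ) × (Fin m → ℂ) => star z.1 ⬝ᵥ (Φ w *ᵥ z.2) :=
      continuous_fst.star.dotProduct (continuous_const.matrix_mulVec continuous_snd)
    have h3 := (hU.tendsto w).prodMk_nhds (hV.tendsto w)
    have h4 := (hc.tendsto (f w, g w)).comp h3
    simpa only [Function.comp_def] using h4

end Bilinear

end SpectralForm

/-! ### Stationary processes as Hilbert space vectors: filtering, averaging, duality -/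

section HilbertProcess

open Matrix Topology ComplexConjugate

variable {m : ℕ} {H : Type*} [NormedAddCommGroup H] [InnerProductSpace ℝ H]

/-- The frequency response of the evaluation at time `p.1` of the coordinate `p.2`. -/
def coordResp (p : ℤ × Fin m) : ℝ → Fin m → ℂ := freqResp (Finsupp.single p 1)

/-- A family of vectors of a Hilbert space whose Gram matrix has the continuous spectral
density `Φ`. -/
structure HasSpectrum (ξ : ℤ × Fin m → H) (Φ : ℝ → Matrix (Fin m) (Fin m) ℂ) : Prop where
  continuous : Continuous Φ
  inner_eq : ∀ p q, ((inner ℝ (ξ p) (ξ q) : ℝ) : ℂ) = specForm Φ (coordResp p) (coordResp q)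

/-- The output `∑ u(k, a) ξ_{k,a}` of a finitely supported filter. -/
def output (ξ : ℤ × Fin m → H) : (ℤ × Fin m →₀ ℝ) →ₗ[ℝ] H := Finsupp.linearCombination ℝ ξ

theorem output_single (ξ : ℤ × Fin m → H) (p : ℤ × Fin m) :
    output ξ (Finsupp.single p 1) = ξ p := by
  simp [output]

variable {ξ η : ℤ × Fin m → H} {Φ Ψ : ℝ → Matrix (Fin m) (Fin m) ℂ}

theorem HasSpectrum.inner_output (hξ : HasSpectrum ξ Φ) (u v : ℤ × Fin m →₀ ℝ) :
    ((inner ℝ (output ξ u) (output ξ v) : ℝ) : ℂ) = specForm Φ (freqResp u) (freqResp v) := by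
  have hc := fun u : ℤ × Fin m →₀ ℝ => (isRealVec_freqResp u).continuous
  induction u using Finsupp.induction_linear with
  | zero =>
    -- Writing the zero response as a zero multiple lets homogeneity of the form settle this case.
    have : freqResp (0 : ℤ × Fin m →₀ ℝ) = fun w => (0 : ℝ) • freqResp (0 : ℤ × Fin m →₀ ℝ) w := by
      rw [← freqResp_smul, zero_smul]
    rw [this, specForm_smul_left]
    simp
  | add u u' hu hu' =>
    rw [map_add, inner_add_left, Complex.ofReal_add, hu, hu', freqResp_add,
      specForm_add_left hξ.continuous (hc _) (hc _) (hc _)]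
  | single p r =>
    have hp : (Finsupp.single p r : ℤ × Fin m →₀ ℝ) = r • Finsupp.single p 1 := by simp
    rw [hp, map_smul, inner_smul_left, freqResp_smul, specForm_smul_left, output_single]
    rw [Complex.ofReal_mul]
    congr 1
    induction v using Finsupp.induction_linear with
    | zero =>
      have : freqResp (0 : ℤ × Fin m →₀ ℝ) =
          fun w => (0 : ℝ) • freqResp (0 : ℤ × Fin m →₀ ℝ) w := by
        rw [← freqResp_smul, zero_smul]
      rw [this, specForm_smul_right]
      simp
    | add u u' hu hu' =>
      rw [map_add, inner_add_right, Complex.ofReal_add, hu, hu', freqResp_add,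
        specForm_add_right hξ.continuous (hc _) (hc _) (hc _)]
    | single q r =>
      have hq : (Finsupp.single q r : ℤ × Fin m →₀ ℝ) = r • Finsupp.single q 1 := by simp
      rw [hq, map_smul, inner_smul_right, freqResp_smul, specForm_smul_right, output_single,
        Complex.ofReal_mul, hξ.inner_eq]
      rfl

theorem HasSpectrum.norm_sq_output (hξ : HasSpectrum ξ Φ) (u : ℤ × Fin m →₀ ℝ) :
    ‖output ξ u‖ ^ 2 = (specForm Φ (freqResp u) (freqResp u)).re := by
  rw [← hξ.inner_output, Complex.ofReal_re, real_inner_self_eq_norm_sq]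

theorem HasSpectrum.tendsto_output_zero {κ : Type*} {l : Filter κ} [l.IsCountablyGenerated]
    (hξ : HasSpectrum ξ Φ) {u : κ → ℤ × Fin m →₀ ℝ}
    (hu : BddTendsto (fun i => freqResp (u i)) l 0) :
    Tendsto (fun i => ‖output ξ (u i)‖) l (𝓝 0) := by
  have h1 := tendsto_specForm hξ.continuous (fun i => (isRealVec_freqResp (u i)).continuous)
    (fun i => (isRealVec_freqResp (u i)).continuous) hu hu
  have h2 := (Complex.continuous_re.tendsto _).comp h1
  have h3 : (specForm Φ (0 : ℝ → Fin m → ℂ) 0).re = 0 := by simp [specForm]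
  rw [h3] at h2
  have h4 := (Real.continuous_sqrt.tendsto _).comp h2
  rw [Real.sqrt_zero] at h4
  refine h4.congr fun i => ?_
  simp only [Function.comp_apply]
  rw [← hξ.norm_sq_output, Real.sqrt_sq (norm_nonneg _)]

/-- Convergent responses have differences tending boundedly to 0 along pairs of indices, and the
spectral isometry turns this into the Cauchy property. -/
theorem HasSpectrum.exists_tendsto_output [CompleteSpace H] (hξ : HasSpectrum ξ Φ)
    {f : ℝ → Fin m → ℂ} {u : ℕ → ℤ × Fin m →₀ ℝ}
    (hu : BddTendsto (fun n => freqResp (u n)) atTop f) :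
    ∃ h : H, Tendsto (fun n => output ξ (u n)) atTop (𝓝 h) := by
  refine cauchySeq_tendsto_of_complete (cauchySeq_iff_tendsto_dist_atTop_0.2 ?_)
  have h1 : BddTendsto (fun n : ℕ × ℕ => freqResp (u n.1 - u n.2)) atTop 0 := by
    rw [← prod_atTop_atTop_eq]
    have := (hu.comp (tendsto_fst (f := atTop) (g := atTop))).sub
      (hu.comp (tendsto_snd (f := atTop) (g := atTop)))
    simp only [freqResp_sub]
    simp only [sub_self] at this
    exact this
  refine (hξ.tendsto_output_zero h1).congr fun n => ?_
  rw [map_sub, dist_eq_norm]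

/-- Filtering a process with continuous spectrum by a real symbol. -/
theorem HasSpectrum.exists_filter [CompleteSpace H] (hξ : HasSpectrum ξ Φ)
    {A : ℝ → Matrix (Fin m) (Fin m) ℂ} (hA : IsRealSymbol A) :
    ∃ (U : ℕ → ℤ × Fin m → ℤ × Fin m →₀ ℝ) (η : ℤ × Fin m → H),
      (∀ p, Tendsto (fun n => output ξ (U n p)) atTop (𝓝 (η p))) ∧
      HasSpectrum η (fun w => (A w)ᴴ * Φ w * A w) ∧
      ∀ p q, ((inner ℝ (ξ p) (η q) : ℝ) : ℂ) =
        specForm (fun w => Φ w * A w) (coordResp p) (coordResp q) := by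
  have hr := fun p : ℤ × Fin m => hA.mulVec (isRealVec_freqResp (Finsupp.single p 1))
  choose U hU using fun p => (hr p).exists_bddTendsto
  choose η hη using fun p => hξ.exists_tendsto_output (hU p)
  have hc := fun n p => (isRealVec_freqResp (U p n)).continuous
  refine ⟨fun n p => U p n, η, hη, ⟨?_, fun p q => ?_⟩, fun p q => ?_⟩
  · exact (hA.continuous.matrix_conjTranspose.matrix_mul hξ.continuous).matrix_mul hA.continuous
  · have h1 := (Complex.continuous_ofReal.tendsto _).comp ((hη p).inner (𝕜 := ℝ) (hη q))
    have h2 := tendsto_specForm hξ.continuous (fun n => hc n p) (fun n => hc n q) (hU p) (hU q)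
    rw [specForm_mulVec] at h2
    refine tendsto_nhds_unique h1 (h2.congr fun n => ?_)
    simp only [Function.comp_apply]
    rw [hξ.inner_output]
  · have h1 := (Complex.continuous_ofReal.tendsto _).comp
      ((tendsto_const_nhds (x := ξ p)).inner (𝕜 := ℝ) (hη q))
    have hp := isRealVec_freqResp (Finsupp.single p 1)
    have h2 := tendsto_specForm hξ.continuous (fun _ => hp.continuous) (fun n => hc n q)
      (BddTendsto.const hp) (hU q)
    have h3 : specForm Φ (freqResp (Finsupp.single p 1))
        (fun w => A w *ᵥ freqResp (Finsupp.single q 1) w) =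
        specForm (fun w => Φ w * A w) (coordResp p) (coordResp q) := by
      -- The unfiltered process is the one with identity symbol, so only the right side acquires
      -- `A`.
      have := specForm_mulVec (Φ := Φ) (f := coordResp p) (g := coordResp q) (fun _ => 1) A
      simpa [coordResp] using this
    rw [h3] at h2
    refine tendsto_nhds_unique h1 (h2.congr fun n => ?_)
    simp only [Function.comp_apply]
    rw [← hξ.inner_output, output_single]

/-- The time shift of a filter. -/
def shift (k : ℤ) : (ℤ × Fin m →₀ ℝ) →ₗ[ℝ] (ℤ × Fin m →₀ ℝ) :=
  Finsupp.lmapDomain ℝ ℝ fun p => (p.1 + k, p.2)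

theorem shift_single (k : ℤ) (p : ℤ × Fin m) (r : ℝ) :
    shift k (Finsupp.single p r) = Finsupp.single (p.1 + k, p.2) r := by
  simp [shift, Finsupp.mapDomain_single]

theorem shift_shift (k l : ℤ) (u : ℤ × Fin m →₀ ℝ) : shift k (shift l u) = shift (l + k) u := by
  induction u using Finsupp.induction_linear with
  | zero => simp
  | add u v hu hv => simp only [map_add, hu, hv]
  | single p r => simp [shift_single, add_assoc]

theorem shift_zero (u : ℤ × Fin m →₀ ℝ) : shift 0 u = u := by
  induction u using Finsupp.induction_linear with
  | zero => simp
  | add u v hu hv => simp only [map_add, hu, hv]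
  | single p r => simp [shift_single]

theorem freqResp_shift (k : ℤ) (u : ℤ × Fin m →₀ ℝ) (w : ℝ) :
    freqResp (shift k u) w = Complex.exp (Complex.I * w * k) • freqResp u w := by
  induction u using Finsupp.induction_linear with
  | zero => simp [freqResp]
  | add u v hu hv => simp only [map_add, freqResp_add, hu, hv, smul_add]
  | single p r =>
    rw [shift_single, freqResp_single, freqResp_single, ← Pi.single_smul, smul_eq_mul]
    congr 1
    push_cast
    rw [mul_add, Complex.exp_add]
    ring

/-- A shift multiplies the response by a unimodular scalar, which cancels in the form. -/
theorem HasSpectrum.norm_output_shift (hξ : HasSpectrum ξ Φ) (k : ℤ) (u : ℤ × Fin m →₀ ℝ) :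
    ‖output ξ (shift k u)‖ = ‖output ξ u‖ := by
  have h : ∀ w : ℝ, conj (Complex.exp (Complex.I * w * k)) * Complex.exp (Complex.I * w * k)
      = 1 := by
    intro w
    rw [← Complex.exp_conj, ← Complex.exp_add]
    simp
  have : ‖output ξ (shift k u)‖ ^ 2 = ‖output ξ u‖ ^ 2 := by
    rw [hξ.norm_sq_output, hξ.norm_sq_output]
    congr 1
    unfold specForm
    congr 2
    funext w
    rw [freqResp_shift, star_smul, mulVec_smul, smul_dotProduct, dotProduct_smul, smul_smul]
    rw [Complex.star_def, h, one_smul]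
  exact (sq_eq_sq₀ (norm_nonneg _) (norm_nonneg _)).1 this

/-- Cesàro mean of a sequence. -/
def cesaro (f : ℕ → ℝ) (n : ℕ) : ℝ := ((n : ℝ) + 1)⁻¹ * ∑ k ∈ Finset.range (n + 1), f k

theorem cesaro_add (f g : ℕ → ℝ) (n : ℕ) :
    cesaro (fun k => f k + g k) n = cesaro f n + cesaro g n := by
  simp [cesaro, Finset.sum_add_distrib, mul_add]

theorem cesaro_mul (r : ℝ) (f : ℕ → ℝ) (n : ℕ) :
    cesaro (fun k => r * f k) n = r * cesaro f n := by
  simp only [cesaro, ← Finset.mul_sum]; ring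

theorem cesaro_sum {κ : Type*} (s : Finset κ) (f : κ → ℕ → ℝ) (n : ℕ) :
    cesaro (fun k => ∑ c ∈ s, f c k) n = ∑ c ∈ s, cesaro (f c) n := by
  simp only [cesaro]
  rw [Finset.sum_comm, Finset.mul_sum]

theorem abs_cesaro_le {f : ℕ → ℝ} {C : ℝ} (hf : ∀ k, |f k| ≤ C) (n : ℕ) :
    |cesaro f n| ≤ C := by
  rw [cesaro, abs_mul, abs_of_nonneg (by positivity)]
  have h1 : |∑ k ∈ Finset.range (n + 1), f k| ≤ (n + 1) * C := by
    refine (Finset.abs_sum_le_sum_abs _ _).trans ?_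
    refine (Finset.sum_le_sum fun k _ => hf k).trans ?_
    simp
  rw [inv_mul_le_iff₀ (by positivity)]
  exact h1

/-- The difference telescopes to a boundary term divided by n + 1. This is the source of the shift
invariance of averaged correlations. -/
theorem tendsto_cesaro_succ_sub {f : ℕ → ℝ} {C : ℝ} (hf : ∀ k, |f k| ≤ C) :
    Tendsto (fun n => cesaro (fun k => f (k + 1)) n - cesaro f n) atTop (𝓝 0) := by
  have h1 : ∀ n, cesaro (fun k => f (k + 1)) n - cesaro f n =
      ((n : ℝ) + 1)⁻¹ * (f (n + 1) - f 0) := by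
    intro n
    rw [cesaro, cesaro, ← mul_sub, ← Finset.sum_sub_distrib, Finset.sum_range_sub]
  simp only [h1]
  have h2 : Tendsto (fun n : ℕ => 1 / ((n : ℝ) + 1) * (2 * C)) atTop (𝓝 0) := by
    simpa using tendsto_one_div_add_atTop_nhds_zero_nat.mul_const (2 * C)
  refine squeeze_zero_norm (fun n => ?_) h2
  rw [norm_mul, Real.norm_of_nonneg (by positivity), one_div]
  refine mul_le_mul_of_nonneg_left ?_ (by positivity)
  rw [Real.norm_eq_abs]
  have := abs_sub (f (n + 1)) (f 0)
  linarith [hf (n + 1), hf 0]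

theorem exists_tendsto_hyperfilter {f : ℕ → ℝ} {C : ℝ} (hf : ∀ k, |f k| ≤ C) :
    ∃ L, Tendsto f (hyperfilter ℕ) (𝓝 L) := by
  obtain ⟨L, -, hL⟩ := (isCompact_Icc (a := -C) (b := C)).ultrafilter_le_nhds
    ((hyperfilter ℕ).map f) 
    (tendsto_principal.2 (.of_forall fun k => abs_le.1 (hf k)))
  exact ⟨L, hL⟩

/-- The averaged cross-correlation of two stationary processes, as a bilinear form on filters. -/
theorem HasSpectrum.exists_crossForm (hξ : HasSpectrum ξ Φ) (hη : HasSpectrum η Ψ) :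
    ∃ ρ : (ℤ × Fin m →₀ ℝ) →ₗ[ℝ] (ℤ × Fin m →₀ ℝ) →ₗ[ℝ] ℝ,
      (∀ u v, Tendsto (cesaro fun k => inner ℝ (output ξ (shift k u)) (output η (shift k v)))
        (hyperfilter ℕ) (𝓝 (ρ u v))) ∧
      (∀ u v, |ρ u v| ≤ ‖output ξ u‖ * ‖output η v‖) ∧
      ∀ (k : ℤ) u v, ρ (shift k u) (shift k v) = ρ u v := by
  have hb : ∀ u v : ℤ × Fin m →₀ ℝ, ∀ k : ℕ,
      |(inner ℝ (output ξ (shift k u)) (output η (shift k v)) : ℝ)| ≤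
        ‖output ξ u‖ * ‖output η v‖ := by
    intro u v k
    refine (abs_real_inner_le_norm _ _).trans ?_
    rw [hξ.norm_output_shift, hη.norm_output_shift]
  -- A single ultrafilter serves all pairs of filters at once, so bilinearity follows from
  -- uniqueness of limits.
  choose ρ hρ using fun u v => exists_tendsto_hyperfilter (abs_cesaro_le (hb u v))
  let ρ' := LinearMap.mk₂ ℝ ρ
    (fun u u' v => tendsto_nhds_unique (hρ (u + u') v) <| by
      refine ((hρ u v).add (hρ u' v)).congr fun n => ?_
      simp only [map_add, inner_add_left, cesaro_add])
    (fun r u v => tendsto_nhds_unique (hρ (r • u) v) <| by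
      refine ((hρ u v).const_mul r).congr fun n => ?_
      simp only [map_smul, real_inner_smul_left, cesaro_mul])
    (fun u v v' => tendsto_nhds_unique (hρ u (v + v')) <| by
      refine ((hρ u v).add (hρ u v')).congr fun n => ?_
      simp only [map_add, inner_add_right, cesaro_add])
    (fun r u v => tendsto_nhds_unique (hρ u (r • v)) <| by
      refine ((hρ u v).const_mul r).congr fun n => ?_
      simp only [map_smul, real_inner_smul_right, cesaro_mul])
  have h1 : ∀ u v, ρ (shift 1 u) (shift 1 v) = ρ u v := by
    intro u v
    have h2 := (tendsto_cesaro_succ_sub (hb u v)).mono_left (Nat.hyperfilter_le_atTop)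
    have h3 := (hρ (shift 1 u) (shift 1 v)).sub (hρ u v)
    refine sub_eq_zero.1 (tendsto_nhds_unique h3 (h2.congr fun n => ?_))
    congr 2
    funext k
    simp only [shift_shift]
    push_cast
    rw [add_comm]
  refine ⟨ρ', hρ, fun u v => ?_, fun k u v => ?_⟩
  · exact le_of_tendsto (hρ u v).abs (.of_forall fun n => abs_cesaro_le (hb u v) n)
  · change ρ (shift k u) (shift k v) = ρ u v
    induction k with
    | zero => rw [shift_zero, shift_zero]
    | succ k ih => rw [← shift_shift, ← shift_shift, h1, ih]
    | pred k ih =>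
      -- For negative shifts the one-step invariance is applied backwards, to the pair already
      -- shifted by -k-1.
      rw [← ih, ← h1 (shift (-(k : ℤ) - 1) u), shift_shift, shift_shift, sub_add_cancel]

/-- `(2π)⁻¹ ∫ tr M(ω) dω`. -/
def meanTrace (M : ℝ → Matrix (Fin m) (Fin m) ℂ) : ℂ :=
  1 / (2 * Real.pi) * ∫ w in (0 : ℝ)..(2 * Real.pi), (M w).trace

/-- The phases at time `k` cancel, so each summand is the mean of a diagonal entry; in particular
the value is independent of `k`. -/
theorem sum_specForm_coordResp {M : ℝ → Matrix (Fin m) (Fin m) ℂ} (hM : Continuous M) (k : ℤ) :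
    ∑ c, specForm M (coordResp (k, c)) (coordResp (k, c)) = meanTrace M := by
  have h : ∀ w : ℝ, conj (Complex.exp (Complex.I * w * k)) * Complex.exp (Complex.I * w * k)
      = 1 := by
    intro w
    rw [← Complex.exp_conj, ← Complex.exp_add]
    simp
  have h1 : ∀ (w : ℝ) (c : Fin m),
      star (coordResp (k, c) w) ⬝ᵥ (M w *ᵥ coordResp (k, c) w) = M w c c := by
    intro w c
    have : coordResp (k, c) w = Complex.exp (Complex.I * w * k) • Pi.single c 1 := by
      rw [coordResp, freqResp_single, ← Pi.single_smul]
      simp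
    rw [this, star_smul, mulVec_smul, smul_dotProduct, dotProduct_smul, smul_smul,
      Complex.star_def, h, one_smul]
    simp
  simp only [specForm, h1, meanTrace, Matrix.trace, diag_apply]
  rw [← Finset.mul_sum, intervalIntegral.integral_finsetSum]
  exact fun c _ => (hM.matrix_elem c c).intervalIntegrable _ _

/-- The filter with response `ω ↦ conj(û(ω)_a) v̂(ω)`. -/
def adjointFilter (a : Fin m) (u v : ℤ × Fin m →₀ ℝ) : ℤ × Fin m →₀ ℝ :=
  u.sum fun p r => if p.2 = a then r • shift (-p.1) v else 0

theorem freqResp_adjointFilter (a : Fin m) (u v : ℤ × Fin m →₀ ℝ) (w : ℝ) :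
    freqResp (adjointFilter a u v) w = conj (freqResp u w a) • freqResp v w := by
  rw [adjointFilter, Finsupp.sum, freqResp_sum, freqResp_apply, Finsupp.sum, map_sum,
    Finset.sum_smul]
  refine Finset.sum_congr rfl fun p _ => ?_
  split_ifs
  · simp only [freqResp_smul, freqResp_shift]
    rw [map_mul, Complex.conj_ofReal, ← Complex.exp_conj, mul_smul, Complex.coe_smul]
    simp
  · simp [freqResp]

/-- Each tap of `u` is shifted back to time 0 and invariance transfers the opposite shift to `v`.
This substitutes for a cross-spectrum: the adjoint of the first filter is composed with the second.
-/
theorem crossForm_eq_sum_adjointFilter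
    {ρ : (ℤ × Fin m →₀ ℝ) →ₗ[ℝ] (ℤ × Fin m →₀ ℝ) →ₗ[ℝ] ℝ}
    (hρ : ∀ (k : ℤ) u v, ρ (shift k u) (shift k v) = ρ u v) (u v : ℤ × Fin m →₀ ℝ) :
    ρ u v = ∑ a, ρ (Finsupp.single (0, a) 1) (adjointFilter a u v) := by
  have h1 : ρ u v = u.sum fun p r => r * ρ (Finsupp.single p 1) v := by
    conv_lhs => rw [← Finsupp.sum_single u]
    rw [Finsupp.sum, Finsupp.sum, map_sum, LinearMap.sum_apply]
    refine Finset.sum_congr rfl fun p _ => ?_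
    have hp : (Finsupp.single p (u p) : ℤ × Fin m →₀ ℝ) = u p • Finsupp.single p 1 := by simp
    rw [hp, map_smul, LinearMap.smul_apply, smul_eq_mul]
  rw [h1]
  simp only [adjointFilter, Finsupp.sum, map_sum]
  rw [Finset.sum_comm]
  refine Finset.sum_congr rfl fun p _ => ?_
  rw [Finset.sum_eq_single p.2]
  · rw [if_pos rfl, map_smul, smul_eq_mul, ← hρ (-p.1) (Finsupp.single p 1), shift_single]
    simp
  · intro b _ hb
    rw [if_neg (Ne.symm hb), map_zero]
  · simp

/-- Upper bound for the averaged cross-correlation of two processes with given spectra. -/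
theorem HasSpectrum.two_mul_le_meanTrace (hξ : HasSpectrum ξ Φ) (hη : HasSpectrum η Ψ)
    {F G : ℝ → Matrix (Fin m) (Fin m) ℂ} (hF : IsRealSymbol F) (hG : IsRealSymbol G)
    (hGF : ∀ w, G w * (F w)ᴴ = 1) {L : ℝ}
    (hL : Tendsto (cesaro fun k => ∑ c, inner ℝ (ξ (k, c)) (η (k, c))) (hyperfilter ℕ) (𝓝 L)) :
    2 * L ≤ (meanTrace fun w => (F w)ᴴ * Φ w * F w).re +
      (meanTrace fun w => (G w)ᴴ * Ψ w * G w).re := by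
  obtain ⟨ρ, hρ, hρb, hρs⟩ := hξ.exists_crossForm hη
  set e : Fin m → ℤ × Fin m →₀ ℝ := fun c => Finsupp.single (0, c) 1 with he
  have hLe : L = ∑ c, ρ (e c) (e c) := by
    refine tendsto_nhds_unique hL ?_
    refine (tendsto_finsetSum _ fun c _ => hρ (e c) (e c)).congr fun n => ?_
    rw [← cesaro_sum]
    congr 1
    funext k
    refine Finset.sum_congr rfl fun c _ => ?_
    simp only [he, shift_single, zero_add, output_single]
  -- `u c` and `v c` are finite filters approximating the columns F e_c and G e_c.
  choose u hu using fun c => (hF.mulVec (isRealVec_freqResp (e c))).exists_bddTendsto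
  choose v hv using fun c => (hG.mulVec (isRealVec_freqResp (e c))).exists_bddTendsto
  have hcont := fun z : ℤ × Fin m →₀ ℝ => (isRealVec_freqResp z).continuous
  have hul : Tendsto (fun n => ∑ c, ‖output ξ (u c n)‖ ^ 2) atTop
      (𝓝 (meanTrace fun w => (F w)ᴴ * Φ w * F w).re) := by
    have hM := (hF.continuous.matrix_conjTranspose.matrix_mul hξ.continuous).matrix_mul
      hF.continuous
    rw [← sum_specForm_coordResp hM 0, Complex.re_sum]
    refine tendsto_finsetSum _ fun c _ => ?_
    have h2 := tendsto_specForm hξ.continuous (fun n => hcont (u c n)) (fun n => hcont (u c n))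
      (hu c) (hu c)
    rw [specForm_mulVec] at h2
    refine ((Complex.continuous_re.tendsto _).comp h2).congr fun n => ?_
    simp only [Function.comp_apply]
    rw [hξ.norm_sq_output]
  have hvl : Tendsto (fun n => ∑ c, ‖output η (v c n)‖ ^ 2) atTop
      (𝓝 (meanTrace fun w => (G w)ᴴ * Ψ w * G w).re) := by
    have hM := (hG.continuous.matrix_conjTranspose.matrix_mul hη.continuous).matrix_mul
      hG.continuous
    rw [← sum_specForm_coordResp hM 0, Complex.re_sum]
    refine tendsto_finsetSum _ fun c _ => ?_
    have h2 := tendsto_specForm hη.continuous (fun n => hcont (v c n)) (fun n => hcont (v c n))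
      (hv c) (hv c)
    rw [specForm_mulVec] at h2
    refine ((Complex.continuous_re.tendsto _).comp h2).congr fun n => ?_
    simp only [Function.comp_apply]
    rw [hη.norm_sq_output]
  set z : Fin m → ℕ → ℤ × Fin m →₀ ℝ := fun a n => ∑ c, adjointFilter a (u c n) (v c n) with hz
  have hzt : ∀ a, BddTendsto (fun n => freqResp (z a n - e a)) atTop 0 := by
    intro a
    have h1 : BddTendsto (fun n => freqResp (z a n)) atTop (freqResp (e a)) := by
      refine ⟨?_, fun w => ?_⟩
      · choose C hC using fun c => (hu c).bound
        choose D hD using fun c => (hv c).bound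
        refine ⟨∑ c, C c * D c, fun n w => ?_⟩
        simp only [hz, freqResp_sum, freqResp_adjointFilter]
        refine (norm_sum_le _ _).trans (Finset.sum_le_sum fun c _ => ?_)
        rw [norm_smul, RCLike.norm_conj]
        exact mul_le_mul ((norm_le_pi_norm _ a).trans (hC c n w)) (hD c n w) (norm_nonneg _)
          ((norm_nonneg _).trans (hC c n w))
      -- The right-hand side is column `a` of G Fᴴ, so this is where the constraint on `F` and `G`
      -- enters.
      · have h2 : freqResp (e a) w = ∑ c, conj ((F w *ᵥ freqResp (e c) w) a) •
            (G w *ᵥ freqResp (e c) w) := by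
          have h3 : ∀ c, freqResp (e c) w = Pi.single c 1 := by
            intro c; simp [he, freqResp_single]
          simp only [h3]
          ext b
          have h4 := congrFun (congrFun (hGF w) b) a
          simp only [Matrix.mul_apply, conjTranspose_apply, Matrix.one_apply] at h4
          rw [Finset.sum_apply, Pi.single_apply, ← h4]
          refine Finset.sum_congr rfl fun c _ => ?_
          simp [mul_comm]
        rw [h2]
        simp only [hz, freqResp_sum, freqResp_adjointFilter]
        refine tendsto_finsetSum _ fun c _ => ?_
        exact ((Complex.continuous_conj.tendsto _).comp
          (((continuous_apply a).tendsto _).comp ((hu c).tendsto w))).smul ((hv c).tendsto w)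
    have h5 := h1.sub (BddTendsto.const (isRealVec_freqResp (e a)))
    simp only [freqResp_sub]
    simp only [sub_self] at h5
    exact h5
  have hρz : Tendsto (fun n => ∑ c, ρ (u c n) (v c n)) atTop (𝓝 L) := by
    -- After moving all filters to the second argument, the error pairs `e a` with a filter whose
    -- response tends boundedly to 0; the Cauchy-Schwarz bound on ρ then removes it.
    have h1 : ∀ n, ∑ c, ρ (u c n) (v c n) = L + ∑ a, ρ (e a) (z a n - e a) := by
      intro n
      rw [hLe, ← Finset.sum_add_distrib]
      simp only [crossForm_eq_sum_adjointFilter hρs (u _ n)]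
      rw [Finset.sum_comm]
      refine Finset.sum_congr rfl fun a _ => ?_
      rw [map_sub, hz, map_sum]
      ring
    simp only [h1]
    have h2 : Tendsto (fun n => ∑ a, ρ (e a) (z a n - e a)) atTop (𝓝 (∑ a : Fin m, (0 : ℝ))) := by
      refine tendsto_finsetSum _ fun a _ => ?_
      have h3 := (hη.tendsto_output_zero (hzt a)).const_mul ‖output ξ (e a)‖
      rw [mul_zero] at h3
      exact squeeze_zero_norm (fun n => hρb _ _) h3
    simpa using h2.const_add L
  refine le_of_tendsto_of_tendsto' (hρz.const_mul 2) (hul.add hvl) fun n => ?_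
  rw [Finset.mul_sum, ← Finset.sum_add_distrib]
  refine Finset.sum_le_sum fun c _ => ?_
  have h1 := (le_abs_self _).trans (hρb (u c n) (v c n))
  nlinarith [sq_nonneg (‖output ξ (u c n)‖ - ‖output η (v c n)‖)]

end HilbertProcess

/-! ### Elliptical laws as linear images of spherical ones -/

section Elliptical

open Matrix Topology

variable {ι : Type*} [Fintype ι]

theorem map_withDensity_comp {α β : Type*} [MeasurableSpace α] [MeasurableSpace β]
    (μ : Measure α) {e : α → β} (he : Measurable e) {h : β → ℝ≥0∞} (hh : Measurable h) :
    (μ.withDensity fun a => h (e a)).map e = (μ.map e).withDensity h := by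
  ext s hs
  rw [Measure.map_apply he hs, withDensity_apply _ (he hs), withDensity_apply _ hs,
    setLIntegral_map hs hh he]

/-- The rotation invariant measure with density `g(‖z‖²)`. -/
def sphericalMeasure (ι : Type*) [Fintype ι] (g : ℝ → ℝ≥0) : Measure (EuclideanSpace ℝ ι) :=
  volume.withDensity fun z => ENNReal.ofReal (g (‖z‖ ^ 2) : ℝ)

theorem sphericalMeasure_map {g : ℝ → ℝ≥0} (hg : Measurable g)
    (U : EuclideanSpace ℝ ι ≃ₗᵢ[ℝ] EuclideanSpace ℝ ι) :
    (sphericalMeasure ι g).map U = sphericalMeasure ι g := by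
  have h := map_withDensity_comp (volume : Measure (EuclideanSpace ℝ ι))
    U.continuous.measurable (h := fun z => ENNReal.ofReal (g (‖z‖ ^ 2) : ℝ)) (by fun_prop)
  rw [U.measurePreserving.map_eq] at h
  simp only [U.norm_map] at h
  exact h

/-- Substitute v = S^{1/2} z: the quadratic form becomes ‖z‖² and the Jacobian accounts for
det(S)^{-1/2}. The spherical measure depends only on `g`, so it is common to all scatter matrices.
-/
theorem IsElliptical.exists_map [DecidableEq ι] {μ : Measure (EuclideanSpace ℝ ι)} {g : ℝ → ℝ≥0}
    (h : IsElliptical μ g) :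
    ∃ Q : EuclideanSpace ℝ ι →ₗ[ℝ] EuclideanSpace ℝ ι, μ = (sphericalMeasure ι g).map Q := by
  obtain ⟨hg, S, hS, rfl⟩ := h
  have hB := PosDef.sqrt hS
  have hBB := CFC.sqrt_mul_sqrt_self S hS.posSemidef.nonneg
  set B := CFC.sqrt S
  have hu := (Matrix.isUnit_iff_isUnit_det _).1 hB.isUnit
  have hdet : √S.det = B.det := by
    rw [← hBB, det_mul, Real.sqrt_mul_self hB.det_pos.le]
  let Q : EuclideanSpace ℝ ι →ₗ[ℝ] EuclideanSpace ℝ ι := Matrix.toLpLin 2 2 B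
  have hQd : LinearMap.det Q = B.det := LinearMap.det_toLpLin 2 B
  have hq : ∀ z, (Q z).ofLp ⬝ᵥ S⁻¹.mulVec (Q z).ofLp = ‖z‖ ^ 2 := by
    intro z
    have h1 : (Q z).ofLp = B *ᵥ z.ofLp := by simp [Q]
    have h2 : S⁻¹ * B = B⁻¹ := by
      rw [← hBB, Matrix.mul_inv_rev, Matrix.mul_assoc, Matrix.nonsing_inv_mul _ hu, Matrix.mul_one]
    have h3 : Bᵀ = B := by rw [← conjTranspose_eq_transpose_of_trivial]; exact hB.1
    rw [h1, mulVec_mulVec, h2, dotProduct_comm, dotProduct_mulVec, ← mulVec_transpose, h3,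
      mulVec_mulVec, Matrix.mul_nonsing_inv _ hu, one_mulVec, EuclideanSpace.real_norm_sq_eq]
    simp [dotProduct, sq]
  refine ⟨Q, ?_⟩
  have hm : Measurable fun v : EuclideanSpace ℝ ι =>
      ENNReal.ofReal (g (v.ofLp ⬝ᵥ S⁻¹.mulVec v.ofLp) : ℝ) := by
    have hc : Continuous fun v : EuclideanSpace ℝ ι => v.ofLp ⬝ᵥ S⁻¹.mulVec v.ofLp := by
      have : Continuous fun v : EuclideanSpace ℝ ι => v.ofLp := PiLp.continuous_ofLp 2 _
      exact this.dotProduct (continuous_const.matrix_mulVec this)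
    have := hc.measurable
    fun_prop
  have h4 := map_withDensity_comp (volume : Measure (EuclideanSpace ℝ ι))
    Q.continuous_of_finiteDimensional.measurable hm
  simp only [hq] at h4
  rw [sphericalMeasure, h4, Measure.map_linearMap_addHaar_eq_smul_addHaar _
    (by rw [hQd]; exact hB.det_pos.ne'), withDensity_smul_measure, ← withDensity_smul _ hm, hQd,
    hdet, abs_of_pos (inv_pos.2 hB.det_pos)]
  congr 1
  funext v
  rw [ENNReal.ofReal_mul (inv_pos.2 hB.det_pos).le, Pi.smul_apply, smul_eq_mul]

/-- The reflection in the hyperplane orthogonal to `w - w'` exchanges two vectors of equal norm and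
preserves the spherical measure. -/
theorem sphericalMeasure_integral_inner {F : Type*} [NormedAddCommGroup F] [NormedSpace ℝ F]
    {g : ℝ → ℝ≥0} (hg : Measurable g) {w w' : EuclideanSpace ℝ ι} (h : ‖w‖ = ‖w'‖)
    {φ : ℝ → F} (hφ : Continuous φ) :
    ∫ z, φ (inner ℝ w z) ∂sphericalMeasure ι g = ∫ z, φ (inner ℝ w' z) ∂sphericalMeasure ι g := by
  let U := (ℝ ∙ (w - w'))ᗮ.reflection
  have hU : U w = w' := Submodule.reflection_sub h
  conv_rhs => rw [← sphericalMeasure_map hg U]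
  rw [integral_map U.continuous.measurable.aemeasurable
    (Continuous.aestronglyMeasurable (by fun_prop))]
  simp only [← hU, U.inner_map_map]

theorem integral_inner_map {F : Type*} [NormedAddCommGroup F] [NormedSpace ℝ F]
    (ν : Measure (EuclideanSpace ℝ ι)) {φ : ℝ → F} (hφ : Continuous φ)
    (Q : EuclideanSpace ℝ ι →ₗ[ℝ] EuclideanSpace ℝ ι) (v : EuclideanSpace ℝ ι) :
    ∫ z, φ (inner ℝ v z) ∂ν.map Q = ∫ z, φ (inner ℝ (LinearMap.adjoint Q v) z) ∂ν := by
  rw [integral_map Q.continuous_of_finiteDimensional.measurable.aemeasurable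
    (Continuous.aestronglyMeasurable (by fun_prop))]
  simp only [LinearMap.adjoint_inner_left]

/-- For elliptical distributions with the same density generator, the law of a linear functional
is determined by its second moment. -/
theorem IsElliptical.integral_exp_eq [DecidableEq ι] {μ μ' : Measure (EuclideanSpace ℝ ι)}
    {g : ℝ → ℝ≥0}
    (h : IsElliptical μ g) (h' : IsElliptical μ' g) {v v' : EuclideanSpace ℝ ι}
    (hv : ∫ z, (inner ℝ v z) ^ 2 ∂μ = ∫ z, (inner ℝ v' z) ^ 2 ∂μ')
    (h0 : ∫ z, (inner ℝ v z) ^ 2 ∂μ ≠ 0) :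
    ∫ z, Complex.exp ((inner ℝ v z : ℝ) * Complex.I) ∂μ =
      ∫ z, Complex.exp ((inner ℝ v' z : ℝ) * Complex.I) ∂μ' := by
  obtain ⟨Q, rfl⟩ := h.exists_map
  obtain ⟨Q', rfl⟩ := h'.exists_map
  have hg := h.1
  have c1 : Continuous fun r : ℝ => r ^ 2 := by fun_prop
  have c2 : Continuous fun r : ℝ => Complex.exp (r * Complex.I) := by fun_prop
  rw [integral_inner_map _ c1] at h0
  rw [integral_inner_map _ c1, integral_inner_map _ c1] at hv
  rw [integral_inner_map _ c2, integral_inner_map _ c2]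
  set w := LinearMap.adjoint Q v
  set w' := LinearMap.adjoint Q' v'
  have hw : ‖w‖ ≠ 0 := by
    intro hw
    rw [norm_eq_zero] at hw
    exact h0 (by simp [hw])
  -- Rescaling `w` to the norm of `w'` multiplies its second moment by the squared ratio. The
  -- moments agree and are nonzero, so the ratio is 1; no value of the moment has to be computed.
  have hn : ‖(‖w'‖ / ‖w‖) • w‖ = ‖w'‖ := by
    rw [norm_smul, norm_div, norm_norm, norm_norm, div_mul_cancel₀ _ hw]
  have h2 := sphericalMeasure_integral_inner hg hn c1
  simp only [real_inner_smul_left, mul_pow] at h2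
  rw [integral_const_mul, ← hv] at h2
  have h3 : (‖w'‖ / ‖w‖) ^ 2 = 1 := mul_right_cancel₀ h0 (by rw [h2, one_mul])
  have h4 : ‖w'‖ / ‖w‖ = 1 := (pow_eq_one_iff_of_nonneg (by positivity) two_ne_zero).1 h3
  have h5 : ‖w‖ = ‖w'‖ := ((div_eq_one_iff_eq hw).1 h4).symm
  exact sphericalMeasure_integral_inner hg h5 c2

end Elliptical

/-! ### Finite linear functionals on path space -/

section PathFunctionals

open Topology

variable {m : ℕ}

/-- The coordinates of a path. -/
def coords (z : ℤ → EuclideanSpace ℝ (Fin m)) (p : ℤ × Fin m) : ℝ := z p.1 p.2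

/-- A filter supported in [-N, N] sees only the 2N + 1 values of the block starting at -N, whose
length parameter is therefore 2N. Ellipticity of blocks thereby applies to filter outputs. -/
theorem output_coords_eq_inner {N : ℕ} {u : ℤ × Fin m →₀ ℝ}
    (hu : ∀ p ∈ u.support, |p.1| ≤ N) (z : ℤ → EuclideanSpace ℝ (Fin m)) :
    output (coords z) u =
      inner ℝ (WithLp.toLp 2 fun p : Fin (2 * N + 1) × Fin m => u (-(N : ℤ) + (p.1 : ℕ), p.2))
        (block (-(N : ℤ)) (2 * N) z) := by
  let φ : Fin (2 * N + 1) × Fin m → ℤ × Fin m := fun p => (-(N : ℤ) + (p.1 : ℕ), p.2)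
  have hφ : Function.Injective φ := by
    rintro ⟨i, a⟩ ⟨j, b⟩ h
    simp only [φ, Prod.mk.injEq, add_right_inj, Nat.cast_inj] at h
    exact Prod.ext (Fin.ext h.1) h.2
  have hs : u.support ⊆ Finset.univ.image φ := by
    intro p hp
    have := abs_le.1 (hu p hp)
    refine Finset.mem_image.2 ⟨(⟨(p.1 + N).toNat, by omega⟩, p.2), Finset.mem_univ _, ?_⟩
    refine Prod.ext ?_ rfl
    simp only [φ]
    omega
  rw [output, Finsupp.linearCombination_apply,
    Finsupp.sum_of_support_subset _ hs _ (by simp), Finset.sum_image (fun _ _ _ _ h => hφ h),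
    PiLp.inner_apply]
  refine Finset.sum_congr rfl fun p _ => ?_
  simp [φ, coords, block, mul_comm]

theorem exists_support_bound (u v : ℤ × Fin m →₀ ℝ) :
    ∃ N : ℕ, (∀ p ∈ u.support, |p.1| ≤ N) ∧ ∀ p ∈ v.support, |p.1| ≤ N := by
  refine ⟨(u.support ∪ v.support).sup fun p => p.1.natAbs, fun p hp => ?_, fun p hp => ?_⟩
  · rw [Int.abs_eq_natAbs, Nat.cast_le]
    exact Finset.le_sup (f := fun p : ℤ × Fin m => p.1.natAbs) (Finset.mem_union_left _ hp)
  · rw [Int.abs_eq_natAbs, Nat.cast_le]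
    exact Finset.le_sup (f := fun p : ℤ × Fin m => p.1.natAbs) (Finset.mem_union_right _ hp)

theorem measurable_block (a : ℤ) (n : ℕ) :
    Measurable (block a n : (ℤ → EuclideanSpace ℝ (Fin m)) → _) := by
  unfold block
  refine (PiLp.continuous_toLp 2 _).measurable.comp (measurable_pi_lambda _ fun p => ?_)
  have h : Measurable fun v : EuclideanSpace ℝ (Fin m) => v p.2 :=
    (EuclideanSpace.proj (𝕜 := ℝ) p.2).continuous.measurable
  exact h.comp (measurable_pi_apply _)

theorem measurable_output_coords (u : ℤ × Fin m →₀ ℝ) :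
    Measurable fun z : ℤ → EuclideanSpace ℝ (Fin m) => output (coords z) u := by
  obtain ⟨N, hN, -⟩ := exists_support_bound u u
  simp only [output_coords_eq_inner hN]
  exact measurable_const.inner (measurable_block _ _)

variable {Ω Ω' : Type*} [MeasurableSpace Ω] [MeasurableSpace Ω'] {P : Measure Ω} {P' : Measure Ω'}
  {x : ℤ → Ω → EuclideanSpace ℝ (Fin m)} {y : ℤ → Ω' → EuclideanSpace ℝ (Fin m)}

theorem measurable_path (hx : ∀ k, Measurable (x k)) : Measurable fun s k => x k s :=
  measurable_pi_lambda _ hx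

theorem integral_output_coords {F : Type*} [NormedAddCommGroup F] [NormedSpace ℝ F]
    (hx : ∀ k, Measurable (x k)) {N : ℕ} {u : ℤ × Fin m →₀ ℝ}
    (hu : ∀ p ∈ u.support, |p.1| ≤ N) {φ : ℝ → F} (hφ : Continuous φ) :
    ∫ s, φ (output (coords fun k => x k s) u) ∂P =
      ∫ z, φ (inner ℝ
        (WithLp.toLp 2 fun p : Fin (2 * N + 1) × Fin m => u (-(N : ℤ) + (p.1 : ℕ), p.2)) z)
        ∂(P.map fun s => block (-(N : ℤ)) (2 * N) fun k => x k s) := by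
  have hm : Measurable fun s => block (-(N : ℤ)) (2 * N) fun k => x k s :=
    (measurable_block _ _).comp (measurable_path hx)
  rw [integral_map hm.aemeasurable (Continuous.aestronglyMeasurable (by fun_prop))]
  simp only [output_coords_eq_inner hu]

theorem IsEllipticalProcess.integral_exp_eq {g : ℕ → ℝ → ℝ≥0}
    (hxe : IsEllipticalProcess P x g) (hye : IsEllipticalProcess P' y g)
    (hx : ∀ k, Measurable (x k)) (hy : ∀ k, Measurable (y k)) {u v : ℤ × Fin m →₀ ℝ}
    (h : ∫ s, (output (coords fun k => x k s) u) ^ 2 ∂P =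
      ∫ s, (output (coords fun k => y k s) v) ^ 2 ∂P')
    (h0 : ∫ s, (output (coords fun k => x k s) u) ^ 2 ∂P ≠ 0) :
    ∫ s, Complex.exp ((output (coords fun k => x k s) u : ℝ) * Complex.I) ∂P =
      ∫ s, Complex.exp ((output (coords fun k => y k s) v : ℝ) * Complex.I) ∂P' := by
  obtain ⟨N, hu, hv⟩ := exists_support_bound u v
  have c1 : Continuous fun r : ℝ => r ^ 2 := by fun_prop
  have c2 : Continuous fun r : ℝ => Complex.exp (r * Complex.I) := by fun_prop
  rw [integral_output_coords hx hu c1] at h0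
  rw [integral_output_coords hx hu c1, integral_output_coords hy hv c1] at h
  rw [integral_output_coords hx hu c2, integral_output_coords hy hv c2]
  exact (hxe _ _).integral_exp_eq (hye _ _) h h0

/-- A finite measure on path space is determined by the characteristic functions of finite
linear combinations of coordinates. -/
theorem measure_ext_of_output {μ ν : Measure (ℤ → EuclideanSpace ℝ (Fin m))}
    [IsFiniteMeasure μ] [IsFiniteMeasure ν]
    (h : ∀ u : ℤ × Fin m →₀ ℝ, ∫ z, Complex.exp ((output (coords z) u : ℝ) * Complex.I) ∂μ =
      ∫ z, Complex.exp ((output (coords z) u : ℝ) * Complex.I) ∂ν) : μ = ν := by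
  -- It suffices to compare finite-time marginals. A dual functional `T` on such a marginal is the
  -- finite filter whose taps are the values of `T` on the basis vectors.
  refine IsProjectiveLimit.unique (P := fun I : Finset ℤ => ν.map I.restrict) (fun I => ?_)
    fun I => rfl
  refine Measure.ext_of_charFunDual (funext fun T => ?_)
  have hm : Measurable (I.restrict : (ℤ → EuclideanSpace ℝ (Fin m)) → _) :=
    Finset.measurable_restrict I
  have hc : Continuous fun v : (i : I) → EuclideanSpace ℝ (Fin m) =>
    Complex.exp (T v * Complex.I) := by fun_prop
  rw [charFunDual_apply, charFunDual_apply, integral_map hm.aemeasurable hc.aestronglyMeasurable,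
    integral_map hm.aemeasurable hc.aestronglyMeasurable]
  let u : ℤ × Fin m →₀ ℝ := ∑ i : I, ∑ c : Fin m, Finsupp.single ((i : ℤ), c)
    (T (Pi.single i (EuclideanSpace.single c 1)))
  have hu : ∀ z, T (I.restrict z) = output (coords z) u := by
    intro z
    have h1 : I.restrict z = ∑ i : I, ∑ c : Fin m,
        z i c • (Pi.single i (EuclideanSpace.single c 1) :
          (i : I) → EuclideanSpace ℝ (Fin m)) := by
      funext j
      rw [Finset.sum_apply, Finset.sum_eq_single j]
      · ext a
        simp [Finset.sum_apply, Pi.single_apply]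
      · intro i _ hi
        simp [Finset.sum_apply, Pi.single_eq_of_ne hi.symm]
      · simp
    rw [h1]
    simp only [map_sum, map_smul, u, output, Finsupp.linearCombination_single, smul_eq_mul, coords]
    simp only [mul_comm]
  simp only [hu]
  exact h u

end PathFunctionals

/-! ### Second-order theory: L² coordinates, Fourier inversion, transport cost -/

section SecondOrder

open Matrix Topology ComplexConjugate

variable {m : ℕ} {Ω Ω' : Type*} [MeasurableSpace Ω] [MeasurableSpace Ω'] {P : Measure Ω}
  {P' : Measure Ω'} {x y : ℤ → Ω → EuclideanSpace ℝ (Fin m)}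
  {x' : ℤ → Ω' → EuclideanSpace ℝ (Fin m)}

/-- The coordinates of a square integrable process as vectors of `L²`. -/
def procVec (h : ∀ k, MemLp (x k) 2 P) (p : ℤ × Fin m) : Lp ℝ 2 P :=
  ((h p.1).eval_piLp p.2).toLp _

theorem coeFn_procVec (h : ∀ k, MemLp (x k) 2 P) (p : ℤ × Fin m) :
    procVec h p =ᵐ[P] fun s => coords (fun k => x k s) p :=
  MemLp.coeFn_toLp _

theorem coeFn_output {η : ℤ × Fin m → Lp ℝ 2 P} {f : ℤ × Fin m → Ω → ℝ}
    (hη : ∀ p, η p =ᵐ[P] f p) (u : ℤ × Fin m →₀ ℝ) :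
    output η u =ᵐ[P] fun s => output (fun p => f p s) u := by
  induction u using Finsupp.induction_linear with
  | zero =>
    simp only [map_zero]
    exact Lp.coeFn_zero _ _ _
  | add u v hu hv =>
    simp only [map_add]
    filter_upwards [Lp.coeFn_add (output η u) (output η v), hu, hv] with s h1 h2 h3
    rw [h1, Pi.add_apply, h2, h3]
  | single p r =>
    simp only [output, Finsupp.linearCombination_single]
    filter_upwards [Lp.coeFn_smul r (η p), hη p] with s h1 h2
    rw [h1, Pi.smul_apply, h2]

theorem inner_eq_integral {f g : Lp ℝ 2 P} {F G : Ω → ℝ} (hf : f =ᵐ[P] F) (hg : g =ᵐ[P] G) :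
    inner ℝ f g = ∫ s, F s * G s ∂P := by
  rw [L2.inner_def]
  refine integral_congr_ae ?_
  filter_upwards [hf, hg] with s h1 h2
  rw [h1, h2]
  simp [mul_comm]

theorem norm_sq_eq_integral {f : Lp ℝ 2 P} {F : Ω → ℝ} (hf : f =ᵐ[P] F) :
    ‖f‖ ^ 2 = ∫ s, F s ^ 2 ∂P := by
  rw [← real_inner_self_eq_norm_sq, inner_eq_integral hf hf]
  simp only [sq]

theorem IsStationary.inner_procVec (h : IsStationary P x) (p q : ℤ × Fin m) :
    inner ℝ (procVec h.memLp p) (procVec h.memLp q) = autocorr P x 0 (q.1 - p.1) p.2 q.2 := by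
  rw [inner_eq_integral (coeFn_procVec _ p) (coeFn_procVec _ q), h.autocorr_eq 0 p.1]
  simp [autocorr, coords]

theorem integral_exp_int (n : ℤ) :
    ∫ w in (0 : ℝ)..(2 * Real.pi), Complex.exp (Complex.I * w * n) =
      if n = 0 then (2 * Real.pi : ℂ) else 0 := by
  split_ifs with h
  · simp [h]
  · have hc : Complex.I * n ≠ 0 := mul_ne_zero Complex.I_ne_zero (by exact_mod_cast h)
    have h1 : ∀ w : ℝ, Complex.I * w * n = Complex.I * n * w := fun w => by ring
    simp only [h1]
    rw [integral_exp_mul_complex hc]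
    have h2 : Complex.exp (Complex.I * n * ((2 * Real.pi : ℝ) : ℂ)) = 1 := by
      rw [Complex.exp_eq_one_iff]
      exact ⟨n, by push_cast; ring⟩
    rw [h2]
    simp

section Spectrum

theorem spectrumTerm_apply (w : ℝ) (k : ℤ) (a b : Fin m) :
    spectrumTerm P x w k a b =
      Complex.exp (-(Complex.I * w * k)) * (autocorr P x 0 k a b : ℂ) := rfl

theorem norm_spectrumTerm_apply (w : ℝ) (k : ℤ) (a b : Fin m) :
    ‖spectrumTerm P x w k a b‖ = |autocorr P x 0 k a b| := by
  rw [spectrumTerm_apply, norm_mul, Complex.norm_exp]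
  simp

theorem hasSum_powerSpectrum_apply (hsum : ∀ w : ℝ, Summable (spectrumTerm P x w))
    (w : ℝ) (a b : Fin m) :
    HasSum (fun k => spectrumTerm P x w k a b) (powerSpectrum P x w a b) :=
  Pi.hasSum.1 (Pi.hasSum.1 (hsum w).hasSum a) b

/-- The phases are unimodular, so frequency 0 suffices. The result is a majorant uniform in
frequency, used for continuity of the spectrum and for termwise integration. -/
theorem summable_abs_autocorr (hsum : ∀ w : ℝ, Summable (spectrumTerm P x w))
    (a b : Fin m) : Summable fun k => |autocorr P x 0 k a b| := by
  have h := (hasSum_powerSpectrum_apply hsum 0 a b).summable.norm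
  simpa only [norm_spectrumTerm_apply] using h

theorem continuous_powerSpectrum (hsum : ∀ w : ℝ, Summable (spectrumTerm P x w)) :
    Continuous (powerSpectrum P x) := by
  refine continuous_matrix fun a b => ?_
  have h : (fun w => powerSpectrum P x w a b) = fun w => ∑' k, spectrumTerm P x w k a b :=
    funext fun w => (hasSum_powerSpectrum_apply hsum w a b).tsum_eq.symm
  rw [h]
  refine continuous_tsum (fun k => ?_) (summable_abs_autocorr hsum a b)
    fun k w => (norm_spectrumTerm_apply w k a b).le
  simp only [spectrumTerm_apply]
  fun_prop

theorem isRealSymbol_powerSpectrum (hsum : ∀ w : ℝ, Summable (spectrumTerm P x w)) :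
    IsRealSymbol (powerSpectrum P x) where
  continuous := continuous_powerSpectrum hsum
  periodic w := by
    unfold powerSpectrum
    congr 1
    funext k
    ext a b
    rw [spectrumTerm_apply, spectrumTerm_apply]
    congr 1
    rw [Complex.exp_eq_exp_iff_exists_int]
    exact ⟨-k, by push_cast; ring⟩
  neg w := by
    ext a b
    rw [conjHom_apply]
    have h1 := (hasSum_powerSpectrum_apply hsum w a b).map (starRingEnd ℂ)
      Complex.continuous_conj
    refine (hasSum_powerSpectrum_apply hsum (-w) a b).unique ?_
    convert h1 using 1
    funext k
    simp only [Function.comp_apply, spectrumTerm_apply]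
    rw [map_mul, Complex.conj_ofReal, ← Complex.exp_conj]
    simp

/-- Fourier inversion: in the termwise integral, orthogonality of exponentials keeps only the lag q
- p, which is the Gram entry of times p and q. -/
theorem IsStationary.hasSpectrum (h : IsStationary P x)
    (hsum : ∀ w : ℝ, Summable (spectrumTerm P x w)) :
    HasSpectrum (procVec h.memLp) (powerSpectrum P x) where
  continuous := continuous_powerSpectrum hsum
  inner_eq p q := by
    rw [h.inner_procVec]
    have h1 : ∀ w : ℝ, star (coordResp p w) ⬝ᵥ (powerSpectrum P x w *ᵥ coordResp q w) =
        Complex.exp (Complex.I * w * (q.1 - p.1 : ℤ)) * powerSpectrum P x w p.2 q.2 := by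
      intro w
      have hr : ∀ p : ℤ × Fin m,
          coordResp p w = Complex.exp (Complex.I * w * p.1) • Pi.single p.2 1 := by
        intro p
        rw [coordResp, freqResp_single, ← Pi.single_smul]
        simp
      rw [hr, hr, star_smul, mulVec_smul, smul_dotProduct, dotProduct_smul, smul_smul,
        Complex.star_def, ← Complex.exp_conj, ← Complex.exp_add]
      have : conj (Complex.I * w * (p.1 : ℂ)) + Complex.I * w * (q.1 : ℂ) =
          Complex.I * w * (q.1 - p.1 : ℤ) := by
        simp; ring
      rw [this]
      simp
    have h2 : HasSum (fun k : ℤ => ∫ w in (0 : ℝ)..(2 * Real.pi),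
        Complex.exp (Complex.I * w * (q.1 - p.1 : ℤ)) * spectrumTerm P x w k p.2 q.2)
        (∫ w in (0 : ℝ)..(2 * Real.pi),
          Complex.exp (Complex.I * w * (q.1 - p.1 : ℤ)) * powerSpectrum P x w p.2 q.2) := by
      refine intervalIntegral.hasSum_integral_of_dominated_convergence
        (fun k _ => |autocorr P x 0 k p.2 q.2|) (fun k => ?_) (fun k => .of_forall fun w _ => ?_)
        (.of_forall fun w _ => summable_abs_autocorr hsum _ _) intervalIntegrable_const
        (.of_forall fun w _ => (hasSum_powerSpectrum_apply hsum w _ _).mul_left _)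
      · refine Continuous.aestronglyMeasurable ?_
        simp only [spectrumTerm_apply]
        fun_prop
      · rw [norm_mul, norm_spectrumTerm_apply, Complex.norm_exp]
        simp
    have h3 : ∀ k : ℤ, ∫ w in (0 : ℝ)..(2 * Real.pi),
        Complex.exp (Complex.I * w * (q.1 - p.1 : ℤ)) * spectrumTerm P x w k p.2 q.2 =
        if k = q.1 - p.1 then (2 * Real.pi : ℂ) * autocorr P x 0 (q.1 - p.1) p.2 q.2 else 0 := by
      intro k
      have h4 : ∀ w : ℝ, Complex.exp (Complex.I * w * (q.1 - p.1 : ℤ)) *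
          spectrumTerm P x w k p.2 q.2 =
          Complex.exp (Complex.I * w * (q.1 - p.1 - k : ℤ)) * autocorr P x 0 k p.2 q.2 := by
        intro w
        rw [spectrumTerm_apply, ← mul_assoc, ← Complex.exp_add]
        congr 2
        push_cast
        ring
      simp only [h4]
      rw [intervalIntegral.integral_mul_const, integral_exp_int]
      by_cases hk : k = q.1 - p.1
      · simp [hk]
      · rw [if_neg (by omega), if_neg hk, zero_mul]
    simp only [h3] at h2
    rw [specForm]
    simp only [h1]
    rw [← h2.tsum_eq, tsum_ite_eq]
    have : (Real.pi : ℂ) ≠ 0 := by exact_mod_cast Real.pi_ne_zero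
    field_simp

end Spectrum

/-- Second-order data are functions of the law on path space. This and the following lemmas carry
them over to the product space on which a coupling lives. -/
theorem memLp_of_law (hx : ∀ k, Measurable (x k)) (hx' : ∀ k, Measurable (x' k))
    (h : processLaw P x = processLaw P' x') (hm : ∀ k, MemLp (x k) 2 P) (k : ℤ) :
    MemLp (x' k) 2 P' := by
  have hk : StronglyMeasurable fun z : ℤ → EuclideanSpace ℝ (Fin m) => z k :=
    (measurable_pi_apply k).stronglyMeasurable
  have h1 := (memLp_map_measure_iff (p := 2) hk.aestronglyMeasurable
    (measurable_path hx).aemeasurable).2 (hm k)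
  change MemLp _ 2 (processLaw P x) at h1
  rw [h] at h1
  exact (memLp_map_measure_iff (p := 2) hk.aestronglyMeasurable
    (measurable_path hx').aemeasurable).1 h1

theorem autocorr_eq_integral_processLaw (hx : ∀ k, Measurable (x k)) (i k : ℤ) (a b : Fin m) :
    autocorr P x i k a b = ∫ z, coords z (i, a) * coords z (i + k, b) ∂processLaw P x := by
  have hc : ∀ p : ℤ × Fin m, Measurable fun z : ℤ → EuclideanSpace ℝ (Fin m) => coords z p :=
    fun p => (EuclideanSpace.proj (𝕜 := ℝ) p.2).continuous.measurable.comp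
      (measurable_pi_apply p.1)
  have hm : Measurable fun z : ℤ → EuclideanSpace ℝ (Fin m) =>
      coords z (i, a) * coords z (i + k, b) := (hc _).mul (hc _)
  rw [processLaw, integral_map (measurable_path hx).aemeasurable hm.aestronglyMeasurable]
  rfl

theorem autocorr_eq_of_law (hx : ∀ k, Measurable (x k)) (hx' : ∀ k, Measurable (x' k))
    (h : processLaw P x = processLaw P' x') : autocorr P x = autocorr P' x' := by
  funext i k
  ext a b
  rw [autocorr_eq_integral_processLaw hx, autocorr_eq_integral_processLaw hx', h]

theorem IsStationary.of_law (hs : IsStationary P x) (hx : ∀ k, Measurable (x k))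
    (hx' : ∀ k, Measurable (x' k)) (h : processLaw P x = processLaw P' x') :
    IsStationary P' x' where
  memLp := memLp_of_law hx hx' h hs.memLp
  autocorr_eq i j k := by
    rw [← autocorr_eq_of_law hx hx' h]
    exact hs.autocorr_eq i j k

theorem spectrumTerm_eq_of_law (hx : ∀ k, Measurable (x k)) (hx' : ∀ k, Measurable (x' k))
    (h : processLaw P x = processLaw P' x') : spectrumTerm P x = spectrumTerm P' x' := by
  funext w k
  have hR := autocorr_eq_of_law hx hx' h
  rw [spectrumTerm, spectrumTerm, hR]

/-- The transport cost per unit of time, in terms of `L²` norms. -/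
theorem lintegral_block_sub (hx : ∀ k, MemLp (x k) 2 P) (hy : ∀ k, MemLp (y k) 2 P) (i : ℕ) :
    (∫⁻ s, ‖block 0 i (fun k => x k s) - block 0 i (fun k => y k s)‖ₑ ^ (2 : ℝ) ∂P) /
        ((i : ℝ≥0∞) + 1) =
      ENNReal.ofReal (cesaro (fun k => ∑ c, ‖procVec hx (k, c) - procVec hy (k, c)‖ ^ 2) i) := by
  have h1 : ∀ s, ‖block 0 i (fun k => x k s) - block 0 i (fun k => y k s)‖ₑ ^ (2 : ℝ) =
      ENNReal.ofReal (∑ k ∈ Finset.range (i + 1), ∑ c, (x k s c - y k s c) ^ 2) := by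
    intro s
    rw [← ofReal_norm, ENNReal.ofReal_rpow_of_nonneg (norm_nonneg _) zero_le_two,
      Real.rpow_two, EuclideanSpace.norm_sq_eq, Fintype.sum_prod_type, Finset.sum_range]
    simp [block]
  have hm : ∀ (k : ℤ) c, MemLp (fun s => x k s c - y k s c) 2 P :=
    fun k c => ((hx k).eval_piLp c).sub ((hy k).eval_piLp c)
  have h2 : ∀ k : ℤ, ∀ c, ‖procVec hx (k, c) - procVec hy (k, c)‖ ^ 2 =
      ∫ s, (x k s c - y k s c) ^ 2 ∂P := by
    intro k c
    refine norm_sq_eq_integral ?_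
    filter_upwards [Lp.coeFn_sub (procVec hx (k, c)) (procVec hy (k, c)),
      coeFn_procVec hx (k, c), coeFn_procVec hy (k, c)] with s e1 e2 e3
    rw [e1, Pi.sub_apply, e2, e3]
    rfl
  have hint : ∀ k ∈ Finset.range (i + 1),
      Integrable (fun s => ∑ c, (x k s c - y k s c) ^ 2) P :=
    fun k _ => integrable_finsetSum _ fun c _ => (hm k c).integrable_sq
  simp only [h1]
  rw [← ofReal_integral_eq_lintegral_ofReal (integrable_finsetSum _ hint)
    (.of_forall fun s => Finset.sum_nonneg fun _ _ => Finset.sum_nonneg fun _ _ => sq_nonneg _)]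
  have h3 : ((i : ℝ≥0∞) + 1) = ENNReal.ofReal ((i : ℝ) + 1) := by
    rw [ENNReal.ofReal_add (Nat.cast_nonneg _) zero_le_one, ENNReal.ofReal_natCast,
      ENNReal.ofReal_one]
  rw [h3, ← ENNReal.ofReal_div_of_pos (by positivity), cesaro, div_eq_inv_mul]
  congr 2
  rw [integral_finsetSum _ hint]
  refine Finset.sum_congr rfl fun k _ => ?_
  rw [integral_finsetSum _ fun c _ => (hm k c).integrable_sq]
  exact Finset.sum_congr rfl fun c _ => (h2 k c).symm

end SecondOrder

/-! ### Characteristic functions in L² and identification of the filtered law -/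

section CharacteristicFunction

open Topology

variable {m : ℕ} {Ω Ω' : Type*} [MeasurableSpace Ω] [MeasurableSpace Ω'] {P : Measure Ω}
  {P' : Measure Ω'}
  {x : ℤ → Ω → EuclideanSpace ℝ (Fin m)} {y : ℤ → Ω' → EuclideanSpace ℝ (Fin m)}

/-- The characteristic function at `1` of a square integrable random variable. -/
def expMean (f : Lp ℝ 2 P) : ℂ := ∫ s, Complex.exp ((f s : ℝ) * Complex.I) ∂P

theorem norm_exp_mul_I_sub_le (a b : ℝ) :
    ‖Complex.exp (a * Complex.I) - Complex.exp (b * Complex.I)‖ ≤ ‖a - b‖ := by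
  have h : Complex.exp (a * Complex.I) - Complex.exp (b * Complex.I) =
      Complex.exp (b * Complex.I) * (Complex.exp (Complex.I * ((a - b : ℝ) : ℂ)) - 1) := by
    rw [mul_sub, ← Complex.exp_add, mul_one]
    congr 2
    push_cast
    ring
  rw [h, norm_mul, Complex.norm_exp_ofReal_mul_I, one_mul]
  exact Real.norm_exp_I_mul_ofReal_sub_one_le

theorem integrable_exp_mul_I [IsFiniteMeasure P] {f : Ω → ℝ} (hf : AEStronglyMeasurable f P) :
    Integrable (fun s => Complex.exp ((f s : ℝ) * Complex.I)) P := by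
  refine Integrable.of_bound (C := 1) ?_ (.of_forall fun s => ?_)
  · have hc : Continuous fun r : ℝ => Complex.exp (r * Complex.I) := by fun_prop
    exact hc.comp_aestronglyMeasurable hf
  · rw [Complex.norm_exp_ofReal_mul_I]

/-- The map is 1-Lipschitz: so is r ↦ exp(ir), and on a probability space the L¹ norm is at most the
L² norm. -/
theorem continuous_expMean [IsProbabilityMeasure P] : Continuous (expMean : Lp ℝ 2 P → ℂ) := by
  refine LipschitzWith.continuous (K := 1) (LipschitzWith.of_dist_le_mul fun f g => ?_)
  rw [NNReal.coe_one, one_mul, dist_eq_norm, dist_eq_norm, expMean, expMean,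
    ← integral_sub (integrable_exp_mul_I (Lp.aestronglyMeasurable f))
      (integrable_exp_mul_I (Lp.aestronglyMeasurable g))]
  have hL : MemLp (f - g : Lp ℝ 2 P) 1 P := (Lp.memLp (f - g)).mono_exponent one_le_two
  calc ‖∫ s, (Complex.exp ((f s : ℝ) * Complex.I) - Complex.exp ((g s : ℝ) * Complex.I)) ∂P‖
      ≤ ∫ s, ‖(f - g : Lp ℝ 2 P) s‖ ∂P := by
        refine norm_integral_le_of_norm_le (memLp_one_iff_integrable.1 hL).norm ?_
        filter_upwards [Lp.coeFn_sub f g] with s hs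
        rw [hs]
        exact norm_exp_mul_I_sub_le _ _
    _ = (eLpNorm (f - g : Lp ℝ 2 P) 1 P).toReal := by
        rw [integral_norm_eq_lintegral_enorm hL.1, eLpNorm_one_eq_lintegral_enorm]
    _ ≤ (eLpNorm (f - g : Lp ℝ 2 P) 2 P).toReal :=
        ENNReal.toReal_mono (Lp.eLpNorm_ne_top _)
          (eLpNorm_le_eLpNorm_of_exponent_le one_le_two hL.1)
    _ = ‖f - g‖ := (Lp.norm_def _).symm

theorem expMean_congr {f : Lp ℝ 2 P} {F : Ω → ℝ} (h : f =ᵐ[P] F) :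
    expMean f = ∫ s, Complex.exp ((F s : ℝ) * Complex.I) ∂P := by
  refine integral_congr_ae ?_
  filter_upwards [h] with s hs
  rw [hs]

theorem expMean_zero [IsProbabilityMeasure P] : expMean (0 : Lp ℝ 2 P) = 1 := by
  rw [expMean_congr (Lp.coeFn_zero _ _ _)]
  simp

theorem IsEllipticalProcess.expMean_eq [IsProbabilityMeasure P]
    [IsProbabilityMeasure P'] {g : ℕ → ℝ → ℝ≥0}
    (hxe : IsEllipticalProcess P x g) (hye : IsEllipticalProcess P' y g)
    (hx : ∀ k, Measurable (x k)) (hy : ∀ k, Measurable (y k))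
    (hx2 : ∀ k, MemLp (x k) 2 P) (hy2 : ∀ k, MemLp (y k) 2 P') {u v : ℤ × Fin m →₀ ℝ}
    (h : ‖output (procVec hx2) u‖ = ‖output (procVec hy2) v‖) :
    expMean (output (procVec hx2) u) = expMean (output (procVec hy2) v) := by
  have hu := coeFn_output (coeFn_procVec hx2) u
  have hv := coeFn_output (coeFn_procVec hy2) v
  -- The comparison of elliptical laws needs a nonzero second moment; otherwise both outputs vanish
  -- in L².
  by_cases h0 : ‖output (procVec hx2) u‖ = 0
  · rw [norm_eq_zero.1 h0, norm_eq_zero.1 (h.symm.trans h0), expMean_zero, expMean_zero]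
  · rw [expMean_congr hu, expMean_congr hv]
    have h1 := congrArg (· ^ 2) h
    simp only [norm_sq_eq_integral hu, norm_sq_eq_integral hv] at h1
    refine hxe.integral_exp_eq hye hx hy h1 ?_
    have h2 := norm_sq_eq_integral hu
    have h3 := pow_ne_zero 2 h0
    rw [h2] at h3
    exact h3

/-- The limit `f` need not be a finite filter output, so ellipticity does not apply to it directly.
Each approximant is compared with the multiple of the `v` output having the same norm, and the scale
tends to 1. -/
theorem IsEllipticalProcess.expMean_eq_of_tendsto [IsProbabilityMeasure P]
    [IsProbabilityMeasure P'] {g : ℕ → ℝ → ℝ≥0}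
    (hxe : IsEllipticalProcess P x g) (hye : IsEllipticalProcess P' y g)
    (hx : ∀ k, Measurable (x k)) (hy : ∀ k, Measurable (y k))
    (hx2 : ∀ k, MemLp (x k) 2 P) (hy2 : ∀ k, MemLp (y k) 2 P') {u : ℕ → ℤ × Fin m →₀ ℝ}
    {v : ℤ × Fin m →₀ ℝ} {f : Lp ℝ 2 P}
    (hf : Tendsto (fun n => output (procVec hx2) (u n)) atTop (𝓝 f))
    (h : ‖f‖ = ‖output (procVec hy2) v‖) :
    expMean f = expMean (output (procVec hy2) v) := by
  set t := ‖output (procVec hy2) v‖ with ht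
  by_cases h0 : t = 0
  · rw [norm_eq_zero.1 (h.trans h0), norm_eq_zero.1 (ht.symm.trans h0), expMean_zero, expMean_zero]
  · set r : ℕ → ℝ := fun n => ‖output (procVec hx2) (u n)‖ / t with hr
    have h1 : ∀ n, expMean (output (procVec hx2) (u n)) =
        expMean (r n • output (procVec hy2) v) := by
      intro n
      rw [← map_smul]
      refine hxe.expMean_eq hye hx hy hx2 hy2 ?_
      rw [map_smul, norm_smul, ← ht, hr, norm_div, norm_norm,
        Real.norm_of_nonneg (ht ▸ norm_nonneg _), div_mul_cancel₀ _ h0]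
    have h2 : Tendsto r atTop (𝓝 1) := by
      have := hf.norm.div_const t
      rwa [h, div_self h0] at this
    have h3 := (continuous_expMean.tendsto _).comp (h2.smul_const (output (procVec hy2) v))
    rw [one_smul] at h3
    refine tendsto_nhds_unique ((continuous_expMean.tendsto _).comp hf) (h3.congr fun n => ?_)
    simp only [Function.comp_apply, h1]

/-- The process with given square integrable coordinates. -/
def procOf (η : ℤ × Fin m → Lp ℝ 2 P) (k : ℤ) (s : Ω) : EuclideanSpace ℝ (Fin m) :=
  WithLp.toLp 2 fun c => η (k, c) s

theorem measurable_procOf (η : ℤ × Fin m → Lp ℝ 2 P) (k : ℤ) : Measurable (procOf η k) :=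
  (PiLp.continuous_toLp 2 _).measurable.comp
    (measurable_pi_lambda _ fun c => (Lp.stronglyMeasurable (η (k, c))).measurable)

theorem memLp_procOf (η : ℤ × Fin m → Lp ℝ 2 P) (k : ℤ) : MemLp (procOf η k) 2 P :=
  MemLp.of_eval_piLp fun c => Lp.memLp (η (k, c))

theorem procVec_procOf (η : ℤ × Fin m → Lp ℝ 2 P) : procVec (memLp_procOf η) = η :=
  funext fun p => Lp.toLp_coeFn (η p) (Lp.memLp _)

theorem IsEllipticalProcess.processLaw_procOf [IsProbabilityMeasure P]
    [IsProbabilityMeasure P'] {g : ℕ → ℝ → ℝ≥0}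
    (hxe : IsEllipticalProcess P x g) (hye : IsEllipticalProcess P' y g)
    (hx : ∀ k, Measurable (x k)) (hy : ∀ k, Measurable (y k))
    (hx2 : ∀ k, MemLp (x k) 2 P) (hy2 : ∀ k, MemLp (y k) 2 P')
    {U : ℕ → ℤ × Fin m → ℤ × Fin m →₀ ℝ} {η : ℤ × Fin m → Lp ℝ 2 P}
    (hU : ∀ p, Tendsto (fun n => output (procVec hx2) (U n p)) atTop (𝓝 (η p)))
    (hη : ∀ u, ‖output η u‖ = ‖output (procVec hy2) u‖) :
    processLaw P (procOf η) = processLaw P' y := by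
  have hmη := measurable_path (measurable_procOf η)
  have hmy := measurable_path hy
  have : IsProbabilityMeasure (processLaw P (procOf η)) :=
    Measure.isProbabilityMeasure_map hmη.aemeasurable
  have : IsProbabilityMeasure (processLaw P' y) :=
    Measure.isProbabilityMeasure_map hmy.aemeasurable
  refine measure_ext_of_output fun u => ?_
  have hm : StronglyMeasurable fun z : ℤ → EuclideanSpace ℝ (Fin m) =>
      Complex.exp ((output (coords z) u : ℝ) * Complex.I) := by
    have := measurable_output_coords u
    exact Measurable.stronglyMeasurable (by fun_prop)
  rw [processLaw, processLaw, integral_map hmη.aemeasurable hm.aestronglyMeasurable,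
    integral_map hmy.aemeasurable hm.aestronglyMeasurable]
  have h1 := expMean_congr (coeFn_output (coeFn_procVec hy2) u)
  have h2 := expMean_congr (coeFn_output (coeFn_procVec (memLp_procOf η)) u)
  rw [procVec_procOf] at h2
  rw [← h1, ← h2]
  refine hxe.expMean_eq_of_tendsto hye hx hy hx2 hy2
    -- A finite functional of the limit process is approximated by composing `u` with the
    -- approximating filters.
    (u := fun n => Finsupp.linearCombination ℝ (U n) u) ?_ (hη u)
  have h3 : ∀ n, output (procVec hx2) (Finsupp.linearCombination ℝ (U n) u) =
      u.sum fun p r => r • output (procVec hx2) (U n p) := by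
    intro n
    rw [Finsupp.linearCombination_apply, map_finsuppSum]
    simp only [map_smul]
  simp only [h3]
  have h4 : output η u = u.sum fun p r => r • η p := Finsupp.linearCombination_apply ..
  rw [h4]
  exact tendsto_finsetSum _ fun p _ => (hU p).const_smul (u p)

end CharacteristicFunction

/-! ### The two bounds -/

section Main

open Matrix Topology

variable {m : ℕ}

theorem re_meanTrace {M : ℝ → Matrix (Fin m) (Fin m) ℂ} (hM : Continuous M) :
    (meanTrace M).re = 1 / (2 * Real.pi) * ∫ w in (0 : ℝ)..(2 * Real.pi), (M w).trace.re := by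
  have h := Complex.reCLM.intervalIntegral_comp_comm
    (hM.matrix_trace.intervalIntegrable (μ := volume) 0 (2 * Real.pi))
  simp only [Complex.reCLM_apply] at h
  have h1 : (1 / (2 * Real.pi) : ℂ) = ((1 / (2 * Real.pi) : ℝ) : ℂ) := by push_cast; rfl
  rw [meanTrace, h, h1, Complex.re_ofReal_mul]

theorem HasSpectrum.sum_norm_sq {H : Type*} [NormedAddCommGroup H] [InnerProductSpace ℝ H]
    {ξ : ℤ × Fin m → H} {Φ : ℝ → Matrix (Fin m) (Fin m) ℂ} (h : HasSpectrum ξ Φ) (k : ℤ) :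
    ∑ c, ‖ξ (k, c)‖ ^ 2 = (meanTrace Φ).re := by
  rw [← sum_specForm_coordResp h.continuous k, Complex.re_sum]
  refine Finset.sum_congr rfl fun c _ => ?_
  rw [← h.inner_eq, Complex.ofReal_re, real_inner_self_eq_norm_sq]

theorem HasSpectrum.sum_norm_sub_sq {H : Type*} [NormedAddCommGroup H] [InnerProductSpace ℝ H]
    {ξ η : ℤ × Fin m → H} {Φ Ψ : ℝ → Matrix (Fin m) (Fin m) ℂ} (hξ : HasSpectrum ξ Φ)
    (hη : HasSpectrum η Ψ) (k : ℤ) :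
    ∑ c, ‖ξ (k, c) - η (k, c)‖ ^ 2 = (meanTrace Φ).re + (meanTrace Ψ).re +
      -2 * ∑ c, inner ℝ (ξ (k, c)) (η (k, c)) := by
  rw [← hξ.sum_norm_sq k, ← hη.sum_norm_sq k, Finset.mul_sum, ← Finset.sum_add_distrib,
    ← Finset.sum_add_distrib]
  refine Finset.sum_congr rfl fun c _ => ?_
  rw [norm_sub_sq_real]
  ring

theorem cesaro_const (r : ℝ) (n : ℕ) : cesaro (fun _ => r) n = r := by
  rw [cesaro, Finset.sum_const, Finset.card_range, nsmul_eq_mul]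
  push_cast
  field_simp

theorem continuous_buresMatrix {Φ Ψ : ℝ → Matrix (Fin m) (Fin m) ℂ} (hΦ : IsRealSymbol Φ)
    (hΨ : IsRealSymbol Ψ) (hΦ0 : ∀ w, (Φ w).PosDef) (hΨ0 : ∀ w, (Ψ w).PosDef) :
    Continuous fun w => buresMatrix (Φ w) (Ψ w) :=
  (hΦ.continuous.add hΨ.continuous).sub ((hΦ.fidelity hΨ hΦ0 hΨ0).continuous.const_smul (2 : ℂ))

theorem re_meanTrace_buresMatrix {Φ Ψ : ℝ → Matrix (Fin m) (Fin m) ℂ} (hΦ : IsRealSymbol Φ)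
    (hΨ : IsRealSymbol Ψ) (hΦ0 : ∀ w, (Φ w).PosDef) (hΨ0 : ∀ w, (Ψ w).PosDef) :
    (meanTrace fun w => buresMatrix (Φ w) (Ψ w)).re = (meanTrace Φ).re + (meanTrace Ψ).re -
      2 * (meanTrace fun w => fidelity (Φ w) (Ψ w)).re := by
  have h1 := hΦ.continuous.matrix_trace.intervalIntegrable (μ := volume) 0 (2 * Real.pi)
  have h2 := hΨ.continuous.matrix_trace.intervalIntegrable (μ := volume) 0 (2 * Real.pi)
  have h3 := (hΦ.fidelity hΨ hΦ0 hΨ0).continuous.matrix_trace.intervalIntegrable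
    (μ := volume) 0 (2 * Real.pi)
  have h4 : ∀ w, (buresMatrix (Φ w) (Ψ w)).trace =
      (Φ w).trace + (Ψ w).trace - 2 * (fidelity (Φ w) (Ψ w)).trace := by
    intro w
    rw [buresMatrix, trace_sub, trace_add, trace_smul, smul_eq_mul, fidelity]
  have h5 : (meanTrace fun w => buresMatrix (Φ w) (Ψ w)) = meanTrace Φ + meanTrace Ψ -
      2 * meanTrace fun w => fidelity (Φ w) (Ψ w) := by
    simp only [meanTrace, h4]
    rw [intervalIntegral.integral_sub (h1.add h2) (h3.const_mul 2),
      intervalIntegral.integral_add h1 h2, intervalIntegral.integral_const_mul]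
    ring
  rw [h5, Complex.sub_re, Complex.add_re, Complex.mul_re, Complex.re_ofNat, Complex.im_ofNat,
    zero_mul, sub_zero]

variable {Ω Ω' : Type*} [MeasurableSpace Ω] [MeasurableSpace Ω'] {P : Measure Ω} {P' : Measure Ω'}
  {x : ℤ → Ω → EuclideanSpace ℝ (Fin m)} {y : ℤ → Ω' → EuclideanSpace ℝ (Fin m)}

/-- Every coupling of two stationary processes costs at least the mean Bures distance of the
spectra. -/
theorem meanTrace_buresMatrix_le_limsup (hx : ∀ k, Measurable (x k)) (hy : ∀ k, Measurable (y k))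
    (hxs : IsStationary P x) (hys : IsStationary P' y)
    (hxsum : ∀ w : ℝ, Summable (spectrumTerm P x w))
    (hysum : ∀ w : ℝ, Summable (spectrumTerm P' y w))
    (hxpos : ∀ w : ℝ, (powerSpectrum P x w).PosDef)
    (hypos : ∀ w : ℝ, (powerSpectrum P' y w).PosDef)
    {γ : Measure ((ℤ → EuclideanSpace ℝ (Fin m)) × (ℤ → EuclideanSpace ℝ (Fin m)))}
    (hγ : γ ∈ couplings (processLaw P x) (processLaw P' y)) :
    ENNReal.ofReal
        (meanTrace fun w => buresMatrix (powerSpectrum P x w) (powerSpectrum P' y w)).re ≤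
      limsup (fun i : ℕ =>
        (∫⁻ z, ‖block 0 i z.1 - block 0 i z.2‖ₑ ^ (2 : ℝ) ∂γ) / ((i : ℝ≥0∞) + 1)) atTop := by
  have hm1 : ∀ k, Measurable fun z : (ℤ → EuclideanSpace ℝ (Fin m)) ×
      (ℤ → EuclideanSpace ℝ (Fin m)) => z.1 k := fun k =>
    (measurable_pi_apply k).comp measurable_fst
  have hm2 : ∀ k, Measurable fun z : (ℤ → EuclideanSpace ℝ (Fin m)) ×
      (ℤ → EuclideanSpace ℝ (Fin m)) => z.2 k := fun k =>
    (measurable_pi_apply k).comp measurable_snd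
  have hl1 : processLaw P x = processLaw γ fun k z => z.1 k := hγ.1.symm
  have hl2 : processLaw P' y = processLaw γ fun k z => z.2 k := hγ.2.symm
  have hs1 := hxs.of_law hx hm1 hl1
  have hs2 := hys.of_law hy hm2 hl2
  have hξ := hs1.hasSpectrum (by rwa [← spectrumTerm_eq_of_law hx hm1 hl1])
  have hη := hs2.hasSpectrum (by rwa [← spectrumTerm_eq_of_law hy hm2 hl2])
  have hp1 : powerSpectrum γ (fun k z => z.1 k) = powerSpectrum P x := by
    funext w; rw [powerSpectrum, powerSpectrum, spectrumTerm_eq_of_law hx hm1 hl1]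
  have hp2 : powerSpectrum γ (fun k z => z.2 k) = powerSpectrum P' y := by
    funext w; rw [powerSpectrum, powerSpectrum, spectrumTerm_eq_of_law hy hm2 hl2]
  rw [hp1] at hξ
  rw [hp2] at hη
  have hΦ := isRealSymbol_powerSpectrum hxsum
  have hΨ := isRealSymbol_powerSpectrum hysum
  set Φ := powerSpectrum P x
  set Ψ := powerSpectrum P' y
  set ξ := procVec hs1.memLp
  set η := procVec hs2.memLp
  -- Any bound independent of `k` is enough here: it makes the averaged correlation converge along
  -- the ultrafilter.
  have hb : ∀ k : ℕ, |∑ c, (inner ℝ (ξ (k, c)) (η (k, c)) : ℝ)| ≤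
      (meanTrace Φ).re + (meanTrace Ψ).re := by
    intro k
    rw [← hξ.sum_norm_sq k, ← hη.sum_norm_sq k, ← Finset.sum_add_distrib]
    refine (Finset.abs_sum_le_sum_abs _ _).trans (Finset.sum_le_sum fun c _ => ?_)
    refine (abs_real_inner_le_norm _ _).trans ?_
    nlinarith [sq_nonneg (‖ξ (k, c)‖ - ‖η (k, c)‖), sq_nonneg ‖ξ (k, c)‖, sq_nonneg ‖η (k, c)‖]
  obtain ⟨L, hL⟩ := exists_tendsto_hyperfilter (abs_cesaro_le hb)
  have h1 := hξ.two_mul_le_meanTrace hη (hΦ.primalFactor hΨ hxpos hypos)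
    (hΦ.dualFactor hΨ hxpos hypos)
    (fun w => dualFactor_mul_conjTranspose_primalFactor (hxpos w) (hypos w)) hL
  simp only [primalFactor_conj (hxpos _) (hypos _), dualFactor_conj (hxpos _) (hypos _)] at h1
  have h2 : Tendsto (fun i : ℕ =>
      (∫⁻ z, ‖block 0 i z.1 - block 0 i z.2‖ₑ ^ (2 : ℝ) ∂γ) / ((i : ℝ≥0∞) + 1))
      (hyperfilter ℕ)
      (𝓝 (ENNReal.ofReal ((meanTrace Φ).re + (meanTrace Ψ).re + -2 * L))) := by
    have h3 : ∀ i : ℕ,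
        (∫⁻ z, ‖block 0 i z.1 - block 0 i z.2‖ₑ ^ (2 : ℝ) ∂γ) / ((i : ℝ≥0∞) + 1) =
          ENNReal.ofReal (cesaro (fun k => ∑ c, ‖ξ (k, c) - η (k, c)‖ ^ 2) i) :=
      lintegral_block_sub hs1.memLp hs2.memLp
    simp only [h3]
    refine (ENNReal.continuous_ofReal.tendsto _).comp ?_
    refine ((hL.const_mul (-2)).const_add ((meanTrace Φ).re + (meanTrace Ψ).re)).congr fun n => ?_
    simp only [hξ.sum_norm_sub_sq hη, cesaro_add, cesaro_const, cesaro_mul]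
  calc ENNReal.ofReal (meanTrace fun w => buresMatrix (Φ w) (Ψ w)).re
      ≤ ENNReal.ofReal ((meanTrace Φ).re + (meanTrace Ψ).re + -2 * L) := by
        refine ENNReal.ofReal_le_ofReal ?_
        rw [re_meanTrace_buresMatrix hΦ hΨ hxpos hypos]
        linarith
    _ = limsup _ (hyperfilter ℕ : Filter ℕ) := h2.limsup_eq.symm
    -- A limit along a nonprincipal ultrafilter never exceeds the limsup, so controlling this single
    -- limit suffices.
    _ ≤ _ := limsup_le_limsup_of_le Nat.hyperfilter_le_atTop

/-- For elliptical processes with the same density generator the mean Bures distance of the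
spectra is attained by a coupling. -/
theorem exists_coupling_eq [IsProbabilityMeasure P] [IsProbabilityMeasure P']
    (hx : ∀ k, Measurable (x k)) (hy : ∀ k, Measurable (y k))
    (hxs : IsStationary P x) (hys : IsStationary P' y) {g : ℕ → ℝ → ℝ≥0}
    (hxe : IsEllipticalProcess P x g) (hye : IsEllipticalProcess P' y g)
    (hxsum : ∀ w : ℝ, Summable (spectrumTerm P x w))
    (hysum : ∀ w : ℝ, Summable (spectrumTerm P' y w))
    (hxpos : ∀ w : ℝ, (powerSpectrum P x w).PosDef)
    (hypos : ∀ w : ℝ, (powerSpectrum P' y w).PosDef) :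
    0 ≤ (meanTrace fun w => buresMatrix (powerSpectrum P x w) (powerSpectrum P' y w)).re ∧
    ∃ γ ∈ couplings (processLaw P x) (processLaw P' y), ∀ i : ℕ,
      (∫⁻ z, ‖block 0 i z.1 - block 0 i z.2‖ₑ ^ (2 : ℝ) ∂γ) / ((i : ℝ≥0∞) + 1) =
        ENNReal.ofReal
          (meanTrace fun w => buresMatrix (powerSpectrum P x w) (powerSpectrum P' y w)).re := by
  have hΦ := isRealSymbol_powerSpectrum hxsum
  have hΨ := isRealSymbol_powerSpectrum hysum
  have hξ := hxs.hasSpectrum hxsum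
  have hξ' := hys.hasSpectrum hysum
  have hA := hΦ.transportMap hΨ hxpos hypos
  obtain ⟨U, η, hU, hη, hcross⟩ := hξ.exists_filter hA
  simp only [transportMap_mul_mul (hxpos _) (hypos _)] at hη
  -- Equal spectra give equal norms of all filter outputs, the only input needed to identify the
  -- laws.
  have hlaw : processLaw P (procOf η) = processLaw P' y := by
    refine hxe.processLaw_procOf hye hx hy hxs.memLp hys.memLp hU fun u => ?_
    refine (sq_eq_sq₀ (norm_nonneg _) (norm_nonneg _)).1 ?_
    rw [hη.norm_sq_output, hξ'.norm_sq_output]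
  -- The pair (x, filtered x) is jointly stationary to second order, so the cost is the same at
  -- every time and its averages are constant.
  have hcost : ∀ k : ℤ, ∑ c, ‖procVec hxs.memLp (k, c) - η (k, c)‖ ^ 2 =
      (meanTrace fun w => buresMatrix (powerSpectrum P x w) (powerSpectrum P' y w)).re := by
    intro k
    rw [re_meanTrace_buresMatrix hΦ hΨ hxpos hypos, hξ.sum_norm_sub_sq hη]
    have h1 : ((∑ c, inner ℝ (procVec hxs.memLp (k, c)) (η (k, c)) : ℝ) : ℂ) =
        meanTrace fun w => fidelity (powerSpectrum P x w) (powerSpectrum P' y w) := by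
      push_cast
      simp only [hcross]
      rw [sum_specForm_coordResp (hΦ.continuous.matrix_mul hA.continuous)]
      simp only [meanTrace, trace_mul_transportMap (hxpos _)]
    rw [← h1, Complex.ofReal_re]
    ring
  refine ⟨?_, P.map fun s => (fun k => x k s, fun k => procOf η k s), ⟨?_, ?_⟩, fun i => ?_⟩
  · rw [← hcost 0]
    exact Finset.sum_nonneg fun _ _ => sq_nonneg _
  · rw [Measure.map_map measurable_fst
      ((measurable_path hx).prodMk (measurable_path (measurable_procOf η)))]
    rfl
  · rw [Measure.map_map measurable_snd
      ((measurable_path hx).prodMk (measurable_path (measurable_procOf η))), ← hlaw]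
    rfl
  · have hmeas : Measurable fun z : (ℤ → EuclideanSpace ℝ (Fin m)) ×
        (ℤ → EuclideanSpace ℝ (Fin m)) => ‖block 0 i z.1 - block 0 i z.2‖ₑ ^ (2 : ℝ) := by
      have h1 := measurable_block (m := m) 0 i
      exact ((h1.comp measurable_fst).sub (h1.comp measurable_snd)).enorm.pow_const 2
    rw [lintegral_map hmeas
      ((measurable_path hx).prodMk (measurable_path (measurable_procOf η)))]
    rw [lintegral_block_sub hxs.memLp (memLp_procOf η)]
    simp only [procVec_procOf, hcost, cesaro_const]

end Main

end SpectralWasserstein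

end

theorem theorem1 {m : ℕ}
    {Ω : Type*} [MeasurableSpace Ω] (P : Measure Ω) [IsProbabilityMeasure P]
    {Ω' : Type*} [MeasurableSpace Ω'] (P' : Measure Ω') [IsProbabilityMeasure P']
    (x : ℤ → Ω → EuclideanSpace ℝ (Fin m)) (y : ℤ → Ω' → EuclideanSpace ℝ (Fin m))
    (hx : ∀ k, Measurable (x k)) (hy : ∀ k, Measurable (y k))
    (hxs : SpectralWasserstein.IsStationary P x) (hys : SpectralWasserstein.IsStationary P' y)
    (g : ℕ → ℝ → ℝ≥0)
    (hxe : SpectralWasserstein.IsEllipticalProcess P x g)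
    (hye : SpectralWasserstein.IsEllipticalProcess P' y g)
    (hxsum : ∀ w : ℝ, Summable (SpectralWasserstein.spectrumTerm P x w))
    (hysum : ∀ w : ℝ, Summable (SpectralWasserstein.spectrumTerm P' y w))
    (hxpos : ∀ w : ℝ, (SpectralWasserstein.powerSpectrum P x w).PosDef)
    (hypos : ∀ w : ℝ, (SpectralWasserstein.powerSpectrum P' y w).PosDef) :
    IntervalIntegrable
      (fun w : ℝ => (SpectralWasserstein.buresMatrix (SpectralWasserstein.powerSpectrum P x w)
        (SpectralWasserstein.powerSpectrum P' y w)).trace.re) volume 0 (2 * Real.pi) ∧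
    SpectralWasserstein.avgWasserstein 2
        (SpectralWasserstein.processLaw P x) (SpectralWasserstein.processLaw P' y) =
      ENNReal.ofReal (√(1 / (2 * Real.pi) * ∫ w in (0 : ℝ)..(2 * Real.pi),
        (SpectralWasserstein.buresMatrix (SpectralWasserstein.powerSpectrum P x w)
          (SpectralWasserstein.powerSpectrum P' y w)).trace.re)) := by

  have hΦ := SpectralWasserstein.isRealSymbol_powerSpectrum hxsum
  have hΨ := SpectralWasserstein.isRealSymbol_powerSpectrum hysum
  have hc := SpectralWasserstein.continuous_buresMatrix hΦ hΨ hxpos hypos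
  refine ⟨(Complex.continuous_re.comp hc.matrix_trace).intervalIntegrable _ _, ?_⟩
  obtain ⟨h0, γ, hγ, hcost⟩ := SpectralWasserstein.exists_coupling_eq hx hy hxs hys hxe hye
    hxsum hysum hxpos hypos
  -- Nonnegativity of the mean trace, read off from the optimal coupling, allows the root to pass
  -- through `ENNReal.ofReal`; it remains to compare squared distances.
  rw [← SpectralWasserstein.re_meanTrace hc, Real.sqrt_eq_rpow,
    ← ENNReal.ofReal_rpow_of_nonneg h0 (by norm_num), SpectralWasserstein.avgWasserstein]
  congr 1
  refine le_antisymm (iInf₂_le_of_le γ hγ ?_) (le_iInf₂ fun γ' hγ' => ?_)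
  · simp only [hcost]
    exact (limsup_const _).le
  · exact SpectralWasserstein.meanTrace_buresMatrix_le_limsup hx hy hxs hys hxsum hysum hxpos
      hypos hγ'
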